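/- Let $(\Omega,\mathcal S,P)$ be a probability space, $\xi:\Omega\to\mathbb R^m$ a random vector, and $\theta_1,\theta_2,\dots$ i.i.d. real random variables with law $\pi_\theta$, $|\theta_j|\le 1$ almost surely, the sequence $(\theta_j)_j$ being independent of $\xi$. Let $\nu_b\in\mathbb R$ and $$A(x,y)=a(x,\xi)+\nu_b\sum_{j\ge1}\theta_j\mathbf 1_{[j-1,j)}(y),\qquad A_\varepsilon(x)=A(x,x/\varepsilon),$$ where every realization $x\mapsto a(x,\xi)$ is continuous on $[0,1]$, and assume that for constants $\nu_1,\nu_2$, almost surely, $0<\nu_1\le A(x,y)\le\nu_2$ for all $x\in[0,1]$ and $y\ge0$. Let $P_\xi=P[\,\cdot\mid\xi]$ be a regular conditional probability given $\xi$, with expectation $\mathbb E_\xi$. Let $f\in L^2(0,1)$ be deterministic, let $u_\varepsilon\in H^1_0(0,1)$ be (almost surely, for all $\varepsilon>0$) the weak solution, continuous on $[0,1]$, of $-(A_\varepsilon u_\varepsilon')'=f$ on $(0,1)$, and fix $x\in(0,1)$. Put $F(s)=\int_0^sf$, $$H=(F\mathbf 1_{(0,x)},\,F,\,\mathbf 1_{(0,x)},\,1),\qquad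 Z_\varepsilon=\int_0^1\frac{H(s)}{A_\varepsilon(s)}\,ds\in\mathbb R^4,$$ and let $g:\mathbb R^2\times(0,\infty)^2\to\mathbb R$, $g(z)=-z_1+z_2z_3/z_4$. For a random variable $Y$ and $t\in\mathbb R$ write $\Lambda(Y,t)=\log\mathbb E\,e^{tY}$, and let $V_\alpha=1/(\alpha+\nu_b\theta)$ with $\theta\sim\pi_\theta$. A family $Y_\varepsilon$ of random vectors in $\mathbb R^n$ satisfies the large deviation principle (LDP) under $P_\xi$ with rate function $I:\mathbb R^n\to[0,\infty]$ (lower semicontinuous) if for all $\Gamma\subset\mathbb R^n$ $$-\inf_{\Gamma^\circ}I\le\liminf_{\varepsilon\to0^+}\varepsilon\log P_\xi[Y_\varepsilon\in\Gamma]\le\limsup_{\varepsilon\to0^+}\varepsilon\log P_\xi[Y_\varepsilon\in\Gamma]\le-\inf_{\overline\Gamma}I$$ (with outer probability if $\Gamma$ is not Borel); $I$ is good if $\{I\le\alpha\}$ is compact for every $\alpha\in[0,\infty)$. Then for almost every (fixed) value of $\xi$ the following hold. The function $$\Lambda(\lambda)=\int_0^1\Lambda\big(V_{a(s,\xi)},\,\lambda\cdot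 H(s)\big)\,ds,\qquad\lambda\in\mathbb R^4,$$ is well defined (all expectations and integrals involved are finite), convex and $C^\infty$ on $\mathbb R^4$, and $$\lim_{\varepsilon\to0^+}\varepsilon\log\mathbb E_\xi\,e^{\varepsilon^{-1}\lambda\cdot Z_\varepsilon}=\Lambda(\lambda)\quad\text{for all }\lambda\in\mathbb R^4,$$ where $e^{\varepsilon^{-1}\lambda\cdot Z_\varepsilon}$ is $P_\xi$-integrable for all $\varepsilon>0$. Under $P_\xi$, $Z_\varepsilon$ satisfies an LDP with the good convex rate function $\Lambda^*(z)=\sup_{\lambda\in\mathbb R^4}[\lambda\cdot z-\Lambda(\lambda)]$, and $u_\varepsilon(x)$ satisfies an LDP with the good rate function $I_u(\ell)=\inf\{\Lambda^*(z):z\in\mathbb R^2\times(0,\infty)^2,\ g(z)=\ell\}$. -/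

import Mathlib

open MeasureTheory ProbabilityTheory Filter Topology Set
open scoped ENNReal

noncomputable section

/-! ### Large deviation principles -/

/-- A rate function: a lower semicontinuous map with values in `[0, ∞]`. -/
structure IsRateFunction {E : Type*} [TopologicalSpace E] (I : E → EReal) : Prop where
  nonneg : ∀ y, 0 ≤ I y
  lowerSemicontinuous : LowerSemicontinuous I

/-- A good rate function: all sublevel sets are compact. -/
structure IsGoodRateFunction {E : Type*} [TopologicalSpace E] (I : E → EReal) : Prop
    extends IsRateFunction I where
  isCompact_sublevel : ∀ α : ℝ, 0 ≤ α → IsCompact {y | I y ≤ (α : EReal)}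

/-- Convexity of an extended-real-valued function: its epigraph is convex. -/
def IsConvexEReal {E : Type*} [AddCommMonoid E] [Module ℝ E] (I : E → EReal) : Prop :=
  Convex ℝ {p : E × ℝ | I p.1 ≤ (p.2 : EReal)}

/-- The family `(Y ε)`, `ε → 0⁺`, satisfies under the measure `μ` the large deviation principle
(with speed `1/ε`) with rate function `I`. The measure of a set that is not measurable is its outer
measure, so that `Γ` may be any set; `log 0 = -∞`, and an infimum over the empty set is `+∞`. -/
def SatisfiesLDP {Ω E : Type*} [MeasurableSpace Ω] [TopologicalSpace E]
    (μ : Measure Ω) (Y : ℝ → Ω → E) (I : E → EReal) : Prop :=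
  ∀ Γ : Set E,
    (-(⨅ y ∈ interior Γ, I y) ≤
      liminf (fun ε : ℝ => (ε : EReal) * ENNReal.log (μ {ω | Y ε ω ∈ Γ})) (𝓝[>] 0)) ∧
    (limsup (fun ε : ℝ => (ε : EReal) * ENNReal.log (μ {ω | Y ε ω ∈ Γ})) (𝓝[>] 0) ≤
      -(⨅ y ∈ closure Γ, I y))

/-- The Fenchel–Legendre transform `Λ*(z) = sup_l (l · z - Λ l)`, with values in `[-∞, ∞]`. -/
def fenchelLegendre {E : Type*} [NormedAddCommGroup E] [InnerProductSpace ℝ E]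
    (Λ : E → ℝ) (z : E) : EReal :=
  ⨆ l : E, ((inner ℝ l z - Λ l : ℝ) : EReal)

/-! ### The elliptic boundary value problem on `(0,1)` -/

/-- Test functions: smooth with compact support in the open interval `(0,1)`. -/
def IsTestFunction (φ : ℝ → ℝ) : Prop :=
  ContDiff ℝ (⊤ : ℕ∞) φ ∧ HasCompactSupport φ ∧ tsupport φ ⊆ Ioo 0 1

/-- `v` is the weak derivative of `u` on `(0,1)`. -/
def IsWeakDeriv (u v : ℝ → ℝ) : Prop :=
  ∀ φ : ℝ → ℝ, IsTestFunction φ →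
    ∫ s in Ioo (0 : ℝ) 1, u s * deriv φ s = -∫ s in Ioo (0 : ℝ) 1, v s * φ s

/-- `u` is (the continuous representative of) the weak solution in `H¹₀(0,1)` of
`-(A u')' = f` on `(0,1)`: it is continuous on `[0,1]`, vanishes at the end points, and has a weak
derivative `v ∈ L²(0,1)` such that `∫ A v φ' = ∫ f φ` for all test functions `φ`. -/
def IsWeakSolution (A f u : ℝ → ℝ) : Prop :=
  ContinuousOn u (Icc 0 1) ∧ u 0 = 0 ∧ u 1 = 0 ∧
    ∃ v : ℝ → ℝ, MemLp v 2 (volume.restrict (Ioo (0 : ℝ) 1)) ∧ IsWeakDeriv u v ∧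
      ∀ φ : ℝ → ℝ, IsTestFunction φ →
        ∫ s in Ioo (0 : ℝ) 1, A s * v s * deriv φ s = ∫ s in Ioo (0 : ℝ) 1, f s * φ s

/-! ### The random medium -/

/-- The high-frequency part `b(y) = ν_b ∑_{j ≥ 1} θ_j 1_{[j-1,j)}(y)`. The sequence is indexed from
zero: `t j` stands for `θ_{j+1}`. -/
def highFreq (νb : ℝ) (t : ℕ → ℝ) (y : ℝ) : ℝ :=
  νb * ∑' j : ℕ, (Ico (j : ℝ) (j + 1)).indicator (fun _ => t j) y

/-- The two-scale coefficient `A(s, y) = a(s, ξ) + b(y, θ)` in the realization `ω`. -/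
def medium {Ω : Type*} {m : ℕ} (a : ℝ → (Fin m → ℝ) → ℝ) (νb : ℝ) (ξ : Ω → Fin m → ℝ)
    (θ : ℕ → Ω → ℝ) (ω : Ω) (s y : ℝ) : ℝ :=
  a s (ξ ω) + highFreq νb (fun j => θ j ω) y

/-- The oscillatory coefficient `A_ε(s) = A(s, s/ε)`. -/
def mediumEps {Ω : Type*} {m : ℕ} (a : ℝ → (Fin m → ℝ) → ℝ) (νb : ℝ) (ξ : Ω → Fin m → ℝ)
    (θ : ℕ → Ω → ℝ) (ε : ℝ) (ω : Ω) (s : ℝ) : ℝ :=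
  medium a νb ξ θ ω s (s / ε)

/-! ### The vector of oscillatory integrals and the limiting functional -/

/-- `F(s) = ∫₀ˢ f`. -/
def primitiveF (f : ℝ → ℝ) (s : ℝ) : ℝ := ∫ t in (0 : ℝ)..s, f t

/-- `H = (F 1_{(0,x)}, F, 1_{(0,x)}, 1)`. -/
def Hvec (f : ℝ → ℝ) (x s : ℝ) : EuclideanSpace ℝ (Fin 4) :=
  !₂[(Ioo 0 x).indicator (primitiveF f) s, primitiveF f s, (Ioo 0 x).indicator (fun _ => 1) s, 1]

/-- `Z_i = ∫₀¹ H_i(s) / A(s) ds` for a coefficient `A`. -/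
def Zvec (f : ℝ → ℝ) (x : ℝ) (A : ℝ → ℝ) : EuclideanSpace ℝ (Fin 4) :=
  WithLp.toLp 2 fun i => ∫ s in (0 : ℝ)..1, Hvec f x s i / A s

/-- The domain `ℝ² × (0,∞)²` of `g`. -/
def gDomain : Set (EuclideanSpace ℝ (Fin 4)) := {z | 0 < z 2 ∧ 0 < z 3}

/-- `g(z) = -z₁ + z₂ z₃ / z₄` (coordinates are indexed from zero). -/
def gMap (z : EuclideanSpace ℝ (Fin 4)) : ℝ := -z 0 + z 1 * (z 2 / z 3)

/-- The random variable `V_α = 1 / (α + ν_b θ)`, as a function of the value of `θ`. -/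
def Valpha (νb α t : ℝ) : ℝ := 1 / (α + νb * t)

/-- `Λ(l) = ∫₀¹ Λ(V_{a(s)}, l · H(s)) ds`, where `Λ(Y, t) = log 𝔼 exp (t Y)` is the logarithmic
moment generating function and `θ` has law `πθ`. -/
def limitLogMGF (a₀ : ℝ → ℝ) (νb : ℝ) (πθ : Measure ℝ) (f : ℝ → ℝ) (x : ℝ)
    (l : EuclideanSpace ℝ (Fin 4)) : ℝ :=
  ∫ s in (0 : ℝ)..1, cgf (Valpha νb (a₀ s)) πθ (inner ℝ l (Hvec f x s))

/-- `I(ℓ) = inf {Λ*(z) : z ∈ g⁻¹{ℓ}}`, for `g` on `ℝ² × (0,∞)²`. -/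
def contractedRate (Λ : EuclideanSpace ℝ (Fin 4) → ℝ) (ℓ : ℝ) : EReal :=
  ⨅ z ∈ {z | z ∈ gDomain ∧ gMap z = ℓ}, fenchelLegendre Λ z

end

/-!
The proof conditions on `ξ`. For almost every value `r` of `ξ`, under `P_ξ` the vector `ξ` equals
`r` almost surely, while the `θ_j` are still independent with law `π_θ`
(`ae_ae_eq_of_isCondKernel`, `ae_map_eq_of_indepFun`). So the low-frequency part of the medium
may be taken to be a fixed continuous function, and the rest is `largeDeviations_of_fixed_medium`.

*The limiting logarithmic moment generating function.* On the cell `[ε j, ε (j + 1))` the medium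
depends on the single variable `θ_{j+1}`, hence `Z_ε` is a sum of independent cell contributions
(`Zvec_eq_cellSum`), and `ε log 𝔼_ξ exp (l · Z_ε / ε)` is a sum over the cells, that is, the
integral of a step function of `s`. Inside a cell the integrand `l · H / (a + ν_b θ)` is nearly
constant, so the step function converges boundedly and almost everywhere to `Λ(V_{a(s)}, l · H(s))`,
and dominated convergence gives the limit `Λ` (`hasLimitLogMGF_cellSum`). Since the random variables
`V_α` are uniformly bounded, the derivatives of their cumulant generating functions are locally
bounded uniformly in `s`, and `Λ` is smooth (`contDiff_integral_cgf_inner`).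

*The Gärtner–Ellis theorem* is proved for bounded families and a finite differentiable `Λ`
(`HasLimitLogMGF.satisfiesLDP`). The upper bound is Chernoff's bound for half-spaces combined with
compactness. For the lower bound, a tilted measure concentrates at a value of `∇Λ`, by the same
upper bound applied to the tilted measure; and each `y` with `Λ* y < ∞` is a limit of values of `∇Λ`
at which `Λ*` is at most `Λ* y`, as one sees by minimising `Λ l - l · y + δ ‖l‖² / 2` and letting
`δ → 0`. This makes convex-analytic results on relative interiors unnecessary.

*The solution.* By the lemma of du Bois-Reymond the flux `A_ε u_ε'` equals `c - F` for a constant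
`c`, and the boundary values give `u_ε(x) = g(Z_ε)` (`IsWeakSolution.apply_eq_gMap`). Ellipticity
confines `Z_ε` to a closed set on which `g` agrees with a function that is continuous on the whole
space, and `Λ* = ∞` off that set, so that the contraction principle for continuous maps applies
(`contractedRate_eq_imageRate`, `SatisfiesLDP.comp`).
-/

noncomputable section


/-! ### The Fenchel–Legendre transform -/

section Fenchel

variable {E : Type*} [NormedAddCommGroup E] [InnerProductSpace ℝ E] {Λ : E → ℝ}

theorem le_fenchelLegendre (Λ : E → ℝ) (l z : E) :
    ((inner ℝ l z - Λ l : ℝ) : EReal) ≤ fenchelLegendre Λ z :=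
  le_iSup (fun l : E => ((inner ℝ l z - Λ l : ℝ) : EReal)) l

theorem fenchelLegendre_le_coe_iff {z : E} {r : ℝ} :
    fenchelLegendre Λ z ≤ (r : EReal) ↔ ∀ l, inner ℝ l z - Λ l ≤ r := by
  simp [fenchelLegendre, iSup_le_iff, -EReal.coe_sub]

theorem isConvexEReal_fenchelLegendre (Λ : E → ℝ) : IsConvexEReal (fenchelLegendre Λ) := by
  rintro ⟨z₁, r₁⟩ h₁ ⟨z₂, r₂⟩ h₂ s t hs ht hst
  simp only [mem_ofPred_eq, fenchelLegendre_le_coe_iff] at h₁ h₂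
  simp only [mem_ofPred_eq, Prod.smul_mk, Prod.mk_add_mk, fenchelLegendre_le_coe_iff]
  intro l
  have e₁ := mul_le_mul_of_nonneg_left (h₁ l) hs
  have e₂ := mul_le_mul_of_nonneg_left (h₂ l) ht
  have : Λ l = s * Λ l + t * Λ l := by rw [← add_mul, hst, one_mul]
  simp only [inner_add_right, inner_smul_right, smul_eq_mul]
  linarith

theorem lowerSemicontinuous_fenchelLegendre (Λ : E → ℝ) :
    LowerSemicontinuous (fenchelLegendre Λ) := by
  refine lowerSemicontinuous_iSup fun l => Continuous.lowerSemicontinuous ?_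
  exact continuous_coe_real_ereal.comp (by fun_prop)

theorem fenchelLegendre_nonneg (h0 : Λ 0 = 0) (z : E) : 0 ≤ fenchelLegendre Λ z := by
  simpa [h0] using le_fenchelLegendre Λ 0 z

/-- If `Λ` grows at most linearly, `Λ*` is infinite outside a ball. -/
theorem norm_le_of_fenchelLegendre_le {C : ℝ} (hC0 : 0 ≤ C) (hC : ∀ l, Λ l ≤ C * ‖l‖) {z : E} {α : ℝ}
    (hz : fenchelLegendre Λ z ≤ (α : EReal)) : ‖z‖ ≤ C := by
  rw [fenchelLegendre_le_coe_iff] at hz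
  by_contra! h
  have hz0 : 0 < ‖z‖ := hC0.trans_lt h
  have hq : 0 < ‖z‖ * (‖z‖ - C) := mul_pos hz0 (by linarith)
  obtain ⟨t, ht⟩ := exists_nat_gt (α / (‖z‖ * (‖z‖ - C)))
  rw [div_lt_iff₀ hq] at ht
  have h1 := hz ((t : ℝ) • z)
  have h2 := hC ((t : ℝ) • z)
  rw [inner_smul_left, real_inner_self_eq_norm_sq] at h1
  rw [norm_smul, Real.norm_natCast] at h2
  simp only [conj_trivial] at h1
  nlinarith

theorem isGoodRateFunction_fenchelLegendre [FiniteDimensional ℝ E] {C : ℝ} (h0 : Λ 0 = 0)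
    (hC0 : 0 ≤ C) (hC : ∀ l, Λ l ≤ C * ‖l‖) : IsGoodRateFunction (fenchelLegendre Λ) where
  nonneg := fenchelLegendre_nonneg h0
  lowerSemicontinuous := lowerSemicontinuous_fenchelLegendre Λ
  isCompact_sublevel α _ := by
    refine Metric.isCompact_of_isClosed_isBounded
      ((lowerSemicontinuous_fenchelLegendre Λ).isClosed_preimage (α : EReal)) ?_
    refine (Metric.isBounded_closedBall (x := (0 : E)) (r := C)).subset fun z hz => ?_
    simpa using norm_le_of_fenchelLegendre_le hC0 hC hz

end Fenchel

/-! ### Exponential rates of sets -/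

theorem eventually_two_mul_exp_le {b b' : ℝ} (h : b < b') :
    ∀ᶠ ε : ℝ in 𝓝[>] 0, 2 * Real.exp (ε⁻¹ * b) ≤ Real.exp (ε⁻¹ * b') := by
  have h1 : Tendsto (fun ε : ℝ => Real.exp (ε⁻¹ * (b' - b))) (𝓝[>] 0) atTop :=
    Real.tendsto_exp_atTop.comp (tendsto_inv_nhdsGT_zero.atTop_mul_const (sub_pos.2 h))
  filter_upwards [h1.eventually_ge_atTop 2] with ε hε
  calc 2 * Real.exp (ε⁻¹ * b) ≤ Real.exp (ε⁻¹ * (b' - b)) * Real.exp (ε⁻¹ * b) := by gcongr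
    _ = Real.exp (ε⁻¹ * b') := by rw [← Real.exp_add]; ring_nf

theorem mul_log_ofReal_exp {ε : ℝ} (hε : 0 < ε) (b : ℝ) :
    (ε : EReal) * ENNReal.log (ENNReal.ofReal (Real.exp (ε⁻¹ * b))) = (b : EReal) := by
  rw [ENNReal.log_ofReal_of_pos (Real.exp_pos _), Real.log_exp, ← EReal.coe_mul,
    mul_inv_cancel_left₀ hε.ne']

theorem limsup_mul_log_le {m : ℝ → ℝ≥0∞} {b : ℝ}
    (h : ∀ᶠ ε : ℝ in 𝓝[>] 0, m ε ≤ ENNReal.ofReal (Real.exp (ε⁻¹ * b))) :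
    limsup (fun ε : ℝ => (ε : EReal) * ENNReal.log (m ε)) (𝓝[>] 0) ≤ b := by
  refine limsup_le_of_le (h := ?_)
  filter_upwards [h, self_mem_nhdsWithin] with ε h hε
  rw [← mul_log_ofReal_exp hε b]
  exact mul_le_mul_of_nonneg_left (ENNReal.log_monotone h) (by exact_mod_cast (le_of_lt hε))

theorem le_liminf_mul_log {m : ℝ → ℝ≥0∞} {b : ℝ}
    (h : ∀ᶠ ε : ℝ in 𝓝[>] 0, ENNReal.ofReal (Real.exp (ε⁻¹ * b)) ≤ m ε) :
    (b : EReal) ≤ liminf (fun ε : ℝ => (ε : EReal) * ENNReal.log (m ε)) (𝓝[>] 0) := by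
  refine le_liminf_of_le (h := ?_)
  filter_upwards [h, self_mem_nhdsWithin] with ε h hε
  rw [← mul_log_ofReal_exp hε b]
  exact mul_le_mul_of_nonneg_left (ENNReal.log_monotone h) (by exact_mod_cast (le_of_lt hε))

/-! ### The Gärtner–Ellis theorem for bounded families -/

/-- The family `Y` takes values in the ball of radius `C` and has the limiting logarithmic moment
generating function `Λ` at speed `1/ε`. -/
structure HasLimitLogMGF {Ω E : Type*} [MeasurableSpace Ω] [NormedAddCommGroup E]
    [InnerProductSpace ℝ E] [MeasurableSpace E] (μ : Measure Ω) (Y : ℝ → Ω → E) (Λ : E → ℝ)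
    (C : ℝ) : Prop where
  measurable : ∀ ε, 0 < ε → Measurable (Y ε)
  norm_le : ∀ ε, 0 < ε → ∀ᵐ ω ∂μ, ‖Y ε ω‖ ≤ C
  tendsto : ∀ l, Tendsto (fun ε : ℝ => ε * Real.log (∫ ω, Real.exp (ε⁻¹ * inner ℝ l (Y ε ω)) ∂μ))
    (𝓝[>] 0) (𝓝 (Λ l))

namespace HasLimitLogMGF

variable {Ω E : Type*} [MeasurableSpace Ω] [NormedAddCommGroup E] [InnerProductSpace ℝ E]
  [MeasurableSpace E] {μ : Measure Ω} [IsProbabilityMeasure μ] {Y : ℝ → Ω → E} {Λ : E → ℝ} {C : ℝ}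

theorem map_zero (h : HasLimitLogMGF μ Y Λ C) : Λ 0 = 0 :=
  tendsto_nhds_unique (h.tendsto 0) (by simp)

variable [FiniteDimensional ℝ E] [BorelSpace E]

theorem integrable_exp (h : HasLimitLogMGF μ Y Λ C) {ε : ℝ} (hε : 0 < ε) (l : E) :
    Integrable (fun ω => Real.exp (ε⁻¹ * inner ℝ l (Y ε ω))) μ := by
  have hm := h.measurable ε hε
  refine Integrable.of_bound (C := Real.exp (ε⁻¹ * (‖l‖ * C))) ?_ ?_
  · exact (by fun_prop : Measurable _).aestronglyMeasurable
  · filter_upwards [h.norm_le ε hε] with ω hω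
    rw [Real.norm_eq_abs, abs_of_pos (Real.exp_pos _)]
    gcongr
    exact (real_inner_le_norm _ _).trans (by gcongr)

theorem lintegral_exp (h : HasLimitLogMGF μ Y Λ C) {ε : ℝ} (hε : 0 < ε) (l : E) :
    ∫⁻ ω, ENNReal.ofReal (Real.exp (ε⁻¹ * inner ℝ l (Y ε ω))) ∂μ
      = ENNReal.ofReal (∫ ω, Real.exp (ε⁻¹ * inner ℝ l (Y ε ω)) ∂μ) :=
  (ofReal_integral_eq_lintegral_ofReal (h.integrable_exp hε l)
    (ae_of_all _ fun _ => (Real.exp_pos _).le)).symm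

theorem integral_exp_pos (h : HasLimitLogMGF μ Y Λ C) {ε : ℝ} (hε : 0 < ε) (l : E) :
    0 < ∫ ω, Real.exp (ε⁻¹ * inner ℝ l (Y ε ω)) ∂μ :=
  _root_.MeasureTheory.integral_exp_pos (h.integrable_exp hε l)

theorem eventually_integral_le (h : HasLimitLogMGF μ Y Λ C) {l : E} {b : ℝ} (hb : Λ l < b) :
    ∀ᶠ ε : ℝ in 𝓝[>] 0,
      ∫ ω, Real.exp (ε⁻¹ * inner ℝ l (Y ε ω)) ∂μ ≤ Real.exp (ε⁻¹ * b) := by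
  filter_upwards [(h.tendsto l).eventually_lt_const hb, self_mem_nhdsWithin] with ε h1 hε
  rw [← Real.log_le_iff_le_exp (h.integral_exp_pos hε l), inv_mul_eq_div,
    le_div_iff₀' (by exact hε)]
  exact h1.le

theorem eventually_le_integral (h : HasLimitLogMGF μ Y Λ C) {l : E} {b : ℝ} (hb : b < Λ l) :
    ∀ᶠ ε : ℝ in 𝓝[>] 0,
      Real.exp (ε⁻¹ * b) ≤ ∫ ω, Real.exp (ε⁻¹ * inner ℝ l (Y ε ω)) ∂μ := by
  filter_upwards [(h.tendsto l).eventually_const_lt hb, self_mem_nhdsWithin] with ε h1 hε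
  rw [← Real.le_log_iff_exp_le (h.integral_exp_pos hε l), inv_mul_eq_div,
    div_le_iff₀' (by exact hε)]
  exact h1.le

/-- Chernoff's bound for the exponentially tilted measure and a half-space. -/
theorem eventually_tilted_halfspace_le (h : HasLimitLogMGF μ Y Λ C) {η l : E} {b c : ℝ}
    (hb : Λ (η + l) - c < b) :
    ∀ᶠ ε : ℝ in 𝓝[>] 0,
      ∫⁻ ω in {ω | Y ε ω ∈ {z | c ≤ inner ℝ l z}},
        ENNReal.ofReal (Real.exp (ε⁻¹ * inner ℝ η (Y ε ω))) ∂μ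
      ≤ ENNReal.ofReal (Real.exp (ε⁻¹ * b)) := by
  filter_upwards [h.eventually_integral_le (l := η + l) (b := b + c) (by linarith),
    self_mem_nhdsWithin] with ε h1 hε
  have hε' : (0 : ℝ) < ε := hε
  have hm := h.measurable ε hε
  have hS : MeasurableSet {ω | Y ε ω ∈ {z | c ≤ inner ℝ l z}} :=
    (isClosed_le continuous_const (by fun_prop)).measurableSet.preimage hm
  calc _ ≤ ∫⁻ ω in {ω | Y ε ω ∈ {z | c ≤ inner ℝ l z}}, ENNReal.ofReal (Real.exp (-(ε⁻¹ * c)))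
          * ENNReal.ofReal (Real.exp (ε⁻¹ * inner ℝ (η + l) (Y ε ω))) ∂μ := by
        refine setLIntegral_mono' hS fun ω hω => ?_
        rw [← ENNReal.ofReal_mul (Real.exp_pos _).le, ← Real.exp_add]
        gcongr
        have : ε⁻¹ * c ≤ ε⁻¹ * inner ℝ l (Y ε ω) := by
          gcongr
          exact hω
        rw [inner_add_left]
        linarith
    _ ≤ ∫⁻ ω, ENNReal.ofReal (Real.exp (-(ε⁻¹ * c)))
          * ENNReal.ofReal (Real.exp (ε⁻¹ * inner ℝ (η + l) (Y ε ω))) ∂μ :=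
        setLIntegral_le_lintegral _ _
    _ = ENNReal.ofReal (Real.exp (-(ε⁻¹ * c)))
          * ENNReal.ofReal (∫ ω, Real.exp (ε⁻¹ * inner ℝ (η + l) (Y ε ω)) ∂μ) := by
        rw [lintegral_const_mul' _ _ ENNReal.ofReal_ne_top, h.lintegral_exp hε]
    _ ≤ ENNReal.ofReal (Real.exp (ε⁻¹ * b)) := by
        rw [← ENNReal.ofReal_mul (Real.exp_pos _).le]
        gcongr
        calc _ ≤ Real.exp (-(ε⁻¹ * c)) * Real.exp (ε⁻¹ * (b + c)) := by gcongr
          _ = _ := by rw [← Real.exp_add]; ring_nf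

/-- The upper bound for compact sets, under an exponentially tilted measure: a compact set is covered
by finitely many half-spaces, whose number is absorbed by a slightly larger rate `b'`. -/
theorem exists_eventually_tilted_le (h : HasLimitLogMGF μ Y Λ C) {K : Set E} (hK : IsCompact K)
    {η : E} {b : ℝ} (hb : ∀ z ∈ K, ∃ l, Λ (η + l) - inner ℝ l z < b) :
    ∃ b' < b, ∀ᶠ ε : ℝ in 𝓝[>] 0,
      ∫⁻ ω in {ω | Y ε ω ∈ K}, ENNReal.ofReal (Real.exp (ε⁻¹ * inner ℝ η (Y ε ω))) ∂μ
      ≤ ENNReal.ofReal (Real.exp (ε⁻¹ * b')) := by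
  have hmono : ∀ {s t : Set E} {ε : ℝ}, s ⊆ t →
      ∫⁻ ω in {ω | Y ε ω ∈ s}, ENNReal.ofReal (Real.exp (ε⁻¹ * inner ℝ η (Y ε ω))) ∂μ ≤
      ∫⁻ ω in {ω | Y ε ω ∈ t}, ENNReal.ofReal (Real.exp (ε⁻¹ * inner ℝ η (Y ε ω))) ∂μ :=
    fun hst => lintegral_mono_set fun ω hω => hst hω
  refine hK.induction_on (p := fun s => ∃ b' < b, ∀ᶠ ε : ℝ in 𝓝[>] 0,
      ∫⁻ ω in {ω | Y ε ω ∈ s}, ENNReal.ofReal (Real.exp (ε⁻¹ * inner ℝ η (Y ε ω))) ∂μ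
      ≤ ENNReal.ofReal (Real.exp (ε⁻¹ * b'))) ⟨b - 1, by linarith, by simp⟩ ?_ ?_ ?_
  · rintro s t hst ⟨b', hb', ht⟩
    exact ⟨b', hb', ht.mono fun ε hε => (hmono hst).trans hε⟩
  · rintro s t ⟨b₁, hb₁, hs⟩ ⟨b₂, hb₂, ht⟩
    obtain ⟨b', h1, h2⟩ := exists_between (max_lt hb₁ hb₂)
    refine ⟨b', h2, ?_⟩
    filter_upwards [hs, ht, eventually_two_mul_exp_le h1, self_mem_nhdsWithin] with ε hs ht h2 hε
    have hε' : (0 : ℝ) < ε := hε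
    refine (lintegral_union_le _ {ω | Y ε ω ∈ s} {ω | Y ε ω ∈ t}).trans
      ((add_le_add hs ht).trans ?_)
    rw [← ENNReal.ofReal_add (Real.exp_pos _).le (Real.exp_pos _).le]
    refine ENNReal.ofReal_le_ofReal (le_trans ?_ h2)
    rw [two_mul]
    gcongr
    exacts [le_max_left _ _, le_max_right _ _]
  · intro z hz
    obtain ⟨l, hl⟩ := hb z hz
    obtain ⟨b', h1, h2⟩ := exists_between hl
    obtain ⟨c, h3, h4⟩ : ∃ c, Λ (η + l) - b' < c ∧ c < inner ℝ l z :=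
      exists_between (by linarith)
    refine ⟨{z | c ≤ inner ℝ l z}, mem_nhdsWithin_of_mem_nhds ?_, b', h2,
      h.eventually_tilted_halfspace_le (by linarith)⟩
    filter_upwards [(show Continuous fun z : E => inner ℝ l z by fun_prop).continuousAt
      |>.eventually_const_lt h4] with w hw using hw.le

/-- The upper bound of the Gärtner–Ellis theorem. -/
theorem limsup_le (h : HasLimitLogMGF μ Y Λ C) (Γ : Set E) :
    limsup (fun ε : ℝ => (ε : EReal) * ENNReal.log (μ {ω | Y ε ω ∈ Γ})) (𝓝[>] 0) ≤
      -(⨅ y ∈ closure Γ, fenchelLegendre Λ y) := by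
  rw [EReal.le_neg]
  refine EReal.ge_of_forall_gt_iff_ge.1 fun c hc => ?_
  rw [EReal.le_neg, ← EReal.coe_neg]
  have hK : IsCompact (closure Γ ∩ Metric.closedBall 0 C) :=
    (isCompact_closedBall _ _).inter_left isClosed_closure
  obtain ⟨b', hb', hle⟩ := h.exists_eventually_tilted_le hK (η := 0) (b := -c) fun z hz => by
    obtain ⟨l, hl⟩ := lt_iSup_iff.1 (hc.trans_le (iInf₂_le z hz.1))
    have := EReal.coe_lt_coe_iff.1 hl
    exact ⟨l, by rw [zero_add]; linarith⟩
  refine (limsup_mul_log_le ?_).trans (EReal.coe_le_coe_iff.2 hb'.le)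
  filter_upwards [hle, self_mem_nhdsWithin] with ε hε hpos
  simp only [inner_zero_left, mul_zero, Real.exp_zero, ENNReal.ofReal_one, lintegral_one,
    Measure.restrict_apply_univ] at hε
  refine le_trans (measure_mono_ae ?_) hε
  filter_upwards [h.norm_le ε hpos] with ω hω hΓ
  exact ⟨subset_closure hΓ, by simpa using hω⟩

/-- The lower bound at a value of the gradient of `Λ`: under the measure tilted by `η`, the family
concentrates at the gradient `y` of `Λ` at `η`, because every other point is cut off from `y` by a
half-space that has exponentially small tilted probability. -/
theorem le_liminf_of_hasDerivAt (h : HasLimitLogMGF μ Y Λ C) {η y : E}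
    (hd : ∀ l : E, HasDerivAt (fun t : ℝ => Λ (η + t • l)) (inner ℝ l y) 0)
    {Γ : Set E} (hΓ : Γ ∈ 𝓝 y) :
    ((Λ η - inner ℝ η y : ℝ) : EReal) ≤
      liminf (fun ε : ℝ => (ε : EReal) * ENNReal.log (μ {ω | Y ε ω ∈ Γ})) (𝓝[>] 0) := by
  refine EReal.ge_of_forall_gt_iff_ge.1 fun q hq => ?_
  have hq' : q < Λ η - inner ℝ η y := EReal.coe_lt_coe_iff.1 hq
  obtain ⟨β, hβ1, hβ2⟩ : ∃ β, inner ℝ η y < β ∧ β < Λ η - q := exists_between (by linarith)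
  -- near `y` the tilting factor is at most `exp (β / ε)`
  have hU : Γ ∩ {z | inner ℝ η z < β} ∈ 𝓝 y := inter_mem hΓ
    ((show Continuous fun z : E => inner ℝ η z by fun_prop).continuousAt.eventually_lt_const hβ1)
  obtain ⟨r, hr, hrU⟩ := Metric.mem_nhds_iff.1 hU
  have hK : IsCompact (Metric.closedBall (0 : E) C \ Metric.ball y r) :=
    (isCompact_closedBall _ _).diff Metric.isOpen_ball
  obtain ⟨b, hb, hle⟩ := h.exists_eventually_tilted_le hK (η := η) (b := Λ η) fun z hz => by
    have hzy : 0 < ‖z - y‖ := by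
      rw [norm_pos_iff, sub_ne_zero]
      rintro rfl
      exact hz.2 (Metric.mem_ball_self hr)
    have hder : HasDerivAt (fun t : ℝ => Λ (η + t • (z - y)) - t * inner ℝ (z - y) z)
        (inner ℝ (z - y) y - 1 * inner ℝ (z - y) z) 0 :=
      (hd (z - y)).sub ((hasDerivAt_id (0 : ℝ)).mul_const _)
    have hneg : inner ℝ (z - y) y - 1 * inner ℝ (z - y) z < 0 := by
      rw [one_mul, ← inner_sub_right, ← neg_sub z y, inner_neg_right, real_inner_self_eq_norm_sq]
      exact neg_neg_of_pos (by positivity)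
    obtain ⟨t, ht, htpos⟩ := ((hder.tendsto_slope_zero_right.eventually_lt_const hneg).and
      self_mem_nhdsWithin).exists
    -- a small step `t` in the direction `z - y` separates `z` from `y`
    refine ⟨t • (z - y), ?_⟩
    have htpos : 0 < t := htpos
    simp only [zero_add, zero_smul, add_zero, zero_mul, sub_zero, smul_eq_mul] at ht
    have := (pos_iff_neg_of_mul_neg ht).1 (inv_pos.2 htpos)
    rw [inner_smul_left, conj_trivial]
    linarith
  obtain ⟨b₁, hb₁, hb₂⟩ : ∃ b₁, max b (q + β) < b₁ ∧ b₁ < Λ η :=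
    exists_between (max_lt hb (by linarith))
  refine le_liminf_mul_log ?_
  filter_upwards [hle, h.eventually_le_integral hb₂, eventually_two_mul_exp_le hb₁,
    self_mem_nhdsWithin] with ε hK hT h2 hε
  have hε' : (0 : ℝ) < ε := hε
  have hB : MeasurableSet {ω | Y ε ω ∈ Metric.ball y r} :=
    Metric.isOpen_ball.measurableSet.preimage (h.measurable ε hε)
  have hball : ∫⁻ ω in {ω | Y ε ω ∈ Metric.ball y r},
      ENNReal.ofReal (Real.exp (ε⁻¹ * inner ℝ η (Y ε ω))) ∂μ ≤
      ENNReal.ofReal (Real.exp (ε⁻¹ * β)) * μ {ω | Y ε ω ∈ Γ} :=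
    calc _ ≤ ∫⁻ ω in {ω | Y ε ω ∈ Metric.ball y r}, ENNReal.ofReal (Real.exp (ε⁻¹ * β)) ∂μ := by
          refine setLIntegral_mono' hB fun ω hω => ?_
          have : inner ℝ η (Y ε ω) < β := (hrU hω).2
          gcongr
      _ = ENNReal.ofReal (Real.exp (ε⁻¹ * β)) * μ {ω | Y ε ω ∈ Metric.ball y r} :=
          setLIntegral_const _ _
      _ ≤ _ := by
          gcongr
          exact fun ω hω => (hrU hω).1
  have htot : ENNReal.ofReal (Real.exp (ε⁻¹ * b₁)) ≤
      ENNReal.ofReal (Real.exp (ε⁻¹ * β)) * μ {ω | Y ε ω ∈ Γ} +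
        ENNReal.ofReal (Real.exp (ε⁻¹ * b)) := by
    refine le_trans ?_ ((lintegral_union_le _ _ _).trans (add_le_add hball hK))
    rw [setLIntegral_congr (t := univ), setLIntegral_univ, h.lintegral_exp hε]
    · exact ENNReal.ofReal_le_ofReal hT
    · rw [eventuallyEq_univ]
      filter_upwards [h.norm_le ε hε] with ω hω
      by_cases hr : Y ε ω ∈ Metric.ball y r
      · exact Or.inl hr
      · exact Or.inr ⟨by simpa using hω, hr⟩
  have hsum : ENNReal.ofReal (Real.exp (ε⁻¹ * (q + β))) + ENNReal.ofReal (Real.exp (ε⁻¹ * b)) ≤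
      ENNReal.ofReal (Real.exp (ε⁻¹ * b₁)) := by
    rw [← ENNReal.ofReal_add (Real.exp_pos _).le (Real.exp_pos _).le]
    refine ENNReal.ofReal_le_ofReal (le_trans ?_ h2)
    rw [two_mul]
    gcongr
    exacts [le_max_right _ _, le_max_left _ _]
  have hfin := (ENNReal.add_le_add_iff_right ENNReal.ofReal_ne_top).1 (hsum.trans htot)
  rw [mul_add, add_comm, Real.exp_add, ENNReal.ofReal_mul (Real.exp_pos _).le] at hfin
  exact (ENNReal.mul_le_mul_iff_right (by simpa using Real.exp_pos _) ENNReal.ofReal_ne_top).1 hfin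

/-- The lower bound of the Gärtner–Ellis theorem. A point `y` with `Λ* y < ∞` is a limit of values
`y - δ η` of the gradient of `Λ`, where `η` minimises `Λ l - l · y + δ ‖l‖² / 2`; the rates at these
values are at most `Λ* y`. -/
theorem le_liminf (h : HasLimitLogMGF μ Y Λ C) (hΛ : Differentiable ℝ Λ) (Γ : Set E) :
    -(⨅ y ∈ interior Γ, fenchelLegendre Λ y) ≤
      liminf (fun ε : ℝ => (ε : EReal) * ENNReal.log (μ {ω | Y ε ω ∈ Γ})) (𝓝[>] 0) := by
  rw [EReal.neg_le]
  refine le_iInf₂ fun y hy => ?_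
  rw [EReal.neg_le]
  rcases eq_or_ne (fenchelLegendre Λ y) ⊤ with htop | htop
  · simp [htop]
  obtain ⟨L, hL⟩ : ∃ L : ℝ, fenchelLegendre Λ y = L :=
    ⟨_, (EReal.coe_toReal htop (fun hbot => by
      simpa [hbot] using fenchelLegendre_nonneg h.map_zero y)).symm⟩
  have hL0 : 0 ≤ L := by
    have := fenchelLegendre_nonneg h.map_zero y
    rw [hL] at this
    exact_mod_cast this
  have hLle : ∀ l, inner ℝ l y - Λ l ≤ L := fenchelLegendre_le_coe_iff.1 hL.le
  rw [hL, ← EReal.coe_neg]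
  obtain ⟨r, hr, hrΓ⟩ := Metric.isOpen_iff.1 isOpen_interior y hy
  obtain ⟨δ, hδ, hδr⟩ : ∃ δ > 0, 2 * δ * L < r ^ 2 := by
    refine ⟨r ^ 2 / (2 * (L + 1)), by positivity, ?_⟩
    rw [show 2 * (r ^ 2 / (2 * (L + 1))) * L = r ^ 2 * (L / (L + 1)) by field_simp]
    have : L / (L + 1) < 1 := (div_lt_one (by positivity)).2 (by linarith)
    nlinarith [pow_pos hr 2]
  set φ : E → ℝ := fun l => Λ l - inner ℝ l y + δ / 2 * ‖l‖ ^ 2 with hφ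
  have hφc : Continuous φ := by
    have := hΛ.continuous
    fun_prop
  obtain ⟨η, hη⟩ : ∃ η, ∀ l, φ η ≤ φ l := by
    refine hφc.exists_forall_le ?_
    have h1 : Tendsto (fun l : E => -L + δ / 2 * ‖l‖ ^ 2) (cocompact E) atTop :=
      tendsto_atTop_add_const_left _ _ (((tendsto_pow_atTop two_ne_zero).comp
        (tendsto_norm_cocompact_atTop (E := E))).const_mul_atTop (by positivity))
    refine tendsto_atTop_mono (fun l => ?_) h1
    have := hLle l
    simp only [hφ]
    linarith
  have hηL := hη 0
  simp only [hφ, h.map_zero, inner_zero_left, norm_zero] at hηL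
  have hη1 := hLle η
  -- `φ` is critical at its minimum `η`, so the gradient of `Λ` at `η` is `y - δ η`
  have hd : ∀ l : E, HasDerivAt (fun t : ℝ => Λ (η + t • l)) (inner ℝ l (y - δ • η)) 0 := by
    intro l
    have hline : HasDerivAt (fun t : ℝ => η + t • l) l 0 := by
      simpa using ((hasDerivAt_id (0 : ℝ)).smul_const l).const_add η
    have h1 : HasDerivAt (fun t : ℝ => Λ (η + t • l)) (fderiv ℝ Λ η l) 0 := by
      have h0 : HasFDerivAt Λ (fderiv ℝ Λ η) (η + (0 : ℝ) • l) := by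
        simpa using (hΛ η).hasFDerivAt
      exact h0.comp_hasDerivAt _ hline
    have h2 : HasDerivAt (fun t : ℝ => φ (η + t • l))
        (fderiv ℝ Λ η l - inner ℝ l y + δ / 2 * (2 * inner ℝ η l)) 0 := by
      have h3 := (h1.sub (hline.inner ℝ (hasDerivAt_const (0 : ℝ) y))).add
        ((hline.norm_sq).const_mul (δ / 2))
      exact (h3.congr_deriv (by simp)).congr_of_eventuallyEq (Eventually.of_forall fun t => rfl)
    have hmin : IsLocalMin (fun t : ℝ => φ (η + t • l)) 0 :=
      Eventually.of_forall fun t => by simpa using hη (η + t • l)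
    have h4 := hmin.hasDerivAt_eq_zero h2
    convert h1 using 1
    rw [inner_sub_right, inner_smul_right, real_inner_comm η l]
    linarith
  have hmem : y - δ • η ∈ interior Γ := by
    refine hrΓ ?_
    rw [Metric.mem_ball, dist_eq_norm, sub_sub_cancel_left, norm_neg, norm_smul,
      Real.norm_of_nonneg hδ.le]
    refine lt_of_pow_lt_pow_left₀ 2 hr.le ?_
    nlinarith
  refine le_trans ?_ (h.le_liminf_of_hasDerivAt hd (mem_interior_iff_mem_nhds.1 hmem))
  rw [EReal.coe_le_coe_iff, inner_sub_right, inner_smul_right, real_inner_self_eq_norm_sq]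
  nlinarith [sq_nonneg ‖η‖]

theorem satisfiesLDP (h : HasLimitLogMGF μ Y Λ C) (hΛ : Differentiable ℝ Λ) :
    SatisfiesLDP μ Y (fenchelLegendre Λ) :=
  fun Γ => ⟨h.le_liminf hΛ Γ, h.limsup_le Γ⟩

end HasLimitLogMGF

/-! ### Almost sure modifications and the contraction principle -/

theorem SatisfiesLDP.congr_ae {Ω E : Type*} [MeasurableSpace Ω] [TopologicalSpace E]
    {μ : Measure Ω} {Y Y' : ℝ → Ω → E} {I : E → EReal} (h : SatisfiesLDP μ Y I)
    (hY : ∀ ε : ℝ, 0 < ε → Y ε =ᵐ[μ] Y' ε) : SatisfiesLDP μ Y' I := by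
  intro Γ
  have : (fun ε : ℝ => (ε : EReal) * ENNReal.log (μ {ω | Y ε ω ∈ Γ})) =ᶠ[𝓝[>] 0]
      fun ε : ℝ => (ε : EReal) * ENNReal.log (μ {ω | Y' ε ω ∈ Γ}) := by
    filter_upwards [self_mem_nhdsWithin] with ε hε
    congr 2
    refine measure_congr (eventuallyEq_set.2 ?_)
    filter_upwards [hY ε hε] with ω hω
    rw [hω]
  rw [← liminf_congr this, ← limsup_congr this]
  exact h Γ

/-- The rate function is infinite on an open set that the family avoids. -/
theorem SatisfiesLDP.eq_top_of_ae_notMem {Ω E : Type*} [MeasurableSpace Ω] [TopologicalSpace E]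
    {μ : Measure Ω} {Y : ℝ → Ω → E} {I : E → EReal} (h : SatisfiesLDP μ Y I) {U : Set E}
    (hU : IsOpen U) (hY : ∀ ε : ℝ, 0 < ε → ∀ᵐ ω ∂μ, Y ε ω ∉ U) {y : E} (hy : y ∈ U) :
    I y = ⊤ := by
  have h1 := (h U).1
  have : (fun ε : ℝ => (ε : EReal) * ENNReal.log (μ {ω | Y ε ω ∈ U})) =ᶠ[𝓝[>] 0]
      fun _ => ⊥ := by
    filter_upwards [self_mem_nhdsWithin] with ε hε
    have h0 : μ {ω | Y ε ω ∈ U} = 0 := by simpa [ae_iff] using hY ε hε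
    rw [h0, ENNReal.log_zero, EReal.coe_mul_bot_of_pos hε]
  rw [liminf_congr this, liminf_const, le_bot_iff, EReal.neg_eq_bot_iff, hU.interior_eq] at h1
  exact top_le_iff.1 (h1.ge.trans (iInf₂_le y hy))

/-- The rate function `ℓ ↦ inf {I z : g z = ℓ}`. -/
def imageRate {E F : Type*} (I : E → EReal) (g : E → F) (ℓ : F) : EReal :=
  ⨅ z ∈ {z | g z = ℓ}, I z

theorem imageRate_le {E F : Type*} (I : E → EReal) (g : E → F) (z : E) :
    imageRate I g (g z) ≤ I z :=
  iInf₂_le (f := fun w (_ : w ∈ {w | g w = g z}) => I w) z rfl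

theorem SatisfiesLDP.comp {Ω E F : Type*} [MeasurableSpace Ω] [TopologicalSpace E]
    [TopologicalSpace F] {μ : Measure Ω} {Y : ℝ → Ω → E} {I : E → EReal} (h : SatisfiesLDP μ Y I)
    {g : E → F} (hg : Continuous g) : SatisfiesLDP μ (fun ε ω => g (Y ε ω)) (imageRate I g) := by
  intro Γ
  refine ⟨le_trans ?_ (h (g ⁻¹' Γ)).1, (h (g ⁻¹' Γ)).2.trans ?_⟩ <;> rw [EReal.neg_le_neg_iff]
  · refine le_iInf₂ fun ℓ hℓ => le_iInf₂ fun z (hz : g z = ℓ) => iInf₂_le z ?_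
    exact preimage_interior_subset_interior_preimage hg (by simpa [hz] using hℓ)
  · refine le_iInf₂ fun z hz => ?_
    exact (iInf₂_le (g z) (hg.closure_preimage_subset Γ hz)).trans (imageRate_le I g z)

theorem IsGoodRateFunction.imageRate {E F : Type*} [TopologicalSpace E] [TopologicalSpace F]
    [T2Space F] {I : E → EReal} (h : IsGoodRateFunction I) {g : E → F} (hg : Continuous g) :
    IsGoodRateFunction (imageRate I g) := by
  have hnonneg : ∀ ℓ, 0 ≤ _root_.imageRate I g ℓ := fun ℓ => le_iInf₂ fun z _ => h.nonneg z
  -- by compactness the infimum is attained, so sublevel sets are images of sublevel sets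
  have himage : ∀ α : ℝ, 0 ≤ α →
      {ℓ | _root_.imageRate I g ℓ ≤ (α : EReal)} = g '' {z | I z ≤ (α : EReal)} := by
    intro α hα
    ext ℓ
    constructor
    · intro hℓ
      have hcpt : IsCompact ({z | I z ≤ ((α + 1 : ℝ) : EReal)} ∩ g ⁻¹' {ℓ}) :=
        (h.isCompact_sublevel (α + 1) (by linarith)).inter_right (isClosed_singleton.preimage hg)
      have hlt : _root_.imageRate I g ℓ < ((α + 1 : ℝ) : EReal) :=
        lt_of_le_of_lt hℓ (EReal.coe_lt_coe_iff.2 (by linarith))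
      obtain ⟨z₀, hz₀, hz₀'⟩ : ∃ z, ∃ _ : z ∈ {z | g z = ℓ}, I z < ((α + 1 : ℝ) : EReal) := by
        simpa only [_root_.imageRate, iInf_lt_iff] using hlt
      have hne : ({z | I z ≤ ((α + 1 : ℝ) : EReal)} ∩ g ⁻¹' {ℓ}).Nonempty := ⟨z₀, hz₀'.le, hz₀⟩
      obtain ⟨z, ⟨hz1, hz2⟩, hz⟩ :=
        LowerSemicontinuousOn.exists_isMinOn (f := I) hne hcpt
          (h.lowerSemicontinuous.lowerSemicontinuousOn _)
      refine ⟨z, show I z ≤ α from le_trans (le_iInf₂ fun w hw => ?_) hℓ, hz2⟩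
      by_cases hw' : I w ≤ ((α + 1 : ℝ) : EReal)
      · exact hz ⟨hw', hw⟩
      · exact (show I z ≤ _ from hz1).trans (not_le.1 hw').le
    · rintro ⟨z, hz : I z ≤ α, rfl⟩
      exact (imageRate_le I g z).trans hz
  have hcpt : ∀ α : ℝ, 0 ≤ α → IsCompact {ℓ | _root_.imageRate I g ℓ ≤ (α : EReal)} :=
    fun α hα => himage α hα ▸ (h.isCompact_sublevel α hα).image hg
  refine ⟨⟨hnonneg, lowerSemicontinuous_iff_isClosed_preimage.2 fun y => ?_⟩, hcpt⟩
  rcases lt_or_ge y 0 with hy | hy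
  · rw [show _root_.imageRate I g ⁻¹' Iic y = ∅ from
      eq_empty_of_forall_notMem fun ℓ hℓ => (lt_of_le_of_lt hℓ hy).not_ge (hnonneg ℓ)]
    exact isClosed_empty
  · induction y with
    | bot => simp at hy
    | top => simp
    | coe α => exact (hcpt α (by exact_mod_cast hy)).isClosed


/-! ### Weak derivatives on the unit interval -/

theorem IsTestFunction.eq_zero {φ : ℝ → ℝ} (hφ : IsTestFunction φ) {s : ℝ} (hs : s ∉ Ioo 0 1) :
    φ s = 0 :=
  image_eq_zero_of_notMem_tsupport fun h => hs (hφ.2.2 h)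

theorem IsTestFunction.integrable {φ : ℝ → ℝ} (hφ : IsTestFunction φ) : Integrable φ :=
  hφ.1.continuous.integrable_of_hasCompactSupport hφ.2.1

theorem IsTestFunction.setIntegral_mul {φ : ℝ → ℝ} (hφ : IsTestFunction φ) (w : ℝ → ℝ) :
    ∫ s in Ioo (0 : ℝ) 1, w s * φ s = ∫ s, w s * φ s :=
  setIntegral_eq_integral_of_forall_compl_eq_zero fun s hs => by rw [hφ.eq_zero hs, mul_zero]

theorem IsTestFunction.sub_const_mul {φ ψ : ℝ → ℝ} (hφ : IsTestFunction φ)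
    (hψ : IsTestFunction ψ) (c : ℝ) : IsTestFunction fun s => φ s - c * ψ s := by
  have hK : IsCompact (tsupport φ ∪ tsupport ψ) := hφ.2.1.isCompact.union hψ.2.1.isCompact
  have hsub : Function.support (fun s => φ s - c * ψ s) ⊆ tsupport φ ∪ tsupport ψ := by
    intro s hs
    by_contra hn
    rw [mem_union, not_or] at hn
    exact hs (by simp [image_eq_zero_of_notMem_tsupport hn.1,
      image_eq_zero_of_notMem_tsupport hn.2])
  exact ⟨hφ.1.sub (contDiff_const.mul hψ.1), HasCompactSupport.intro' hK hK.isClosed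
    fun s hs => Function.notMem_support.1 fun h => hs (hsub h),
    (closure_minimal hsub hK.isClosed).trans (union_subset hφ.2.2 hψ.2.2)⟩

/-- A test function with vanishing integral is the derivative of a test function. -/
theorem IsTestFunction.exists_deriv_eq {ψ : ℝ → ℝ} (hψ : IsTestFunction ψ) (h0 : ∫ s, ψ s = 0) :
    ∃ φ, IsTestFunction φ ∧ deriv φ = ψ := by
  have hc := hψ.1.continuous
  have hd : ∀ s, HasDerivAt (fun s => ∫ t in (0 : ℝ)..s, ψ t) (ψ s) s := fun s =>
    intervalIntegral.integral_hasDerivAt_right (hc.intervalIntegrable _ _)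
      (hc.stronglyMeasurableAtFilter _ _) hc.continuousAt
  have hderiv : deriv (fun s => ∫ t in (0 : ℝ)..s, ψ t) = ψ := funext fun s => (hd s).deriv
  have hK : IsCompact (insert (1 / 2 : ℝ) (tsupport ψ)) := hψ.2.1.isCompact.insert _
  have hK01 : insert (1 / 2 : ℝ) (tsupport ψ) ⊆ Ioo 0 1 :=
    insert_subset (by norm_num) hψ.2.2
  obtain ⟨a, haK, ha⟩ := hK.exists_isLeast ⟨_, mem_insert _ _⟩
  obtain ⟨b, hbK, hb⟩ := hK.exists_isGreatest ⟨_, mem_insert _ _⟩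
  have hzero : ∀ s, s ∉ Icc a b → ψ s = 0 := fun s hs =>
    image_eq_zero_of_notMem_tsupport fun h => hs ⟨ha (mem_insert_of_mem _ h),
      hb (mem_insert_of_mem _ h)⟩
  have hprim : ∀ s, s ∉ Icc a b → ∫ t in (0 : ℝ)..s, ψ t = 0 := by
    intro s hs
    rw [mem_Icc, not_and_or, not_le, not_le] at hs
    have ha0 := (hK01 haK).1
    rcases hs with hs | hs
    · rw [intervalIntegral.integral_congr (g := fun _ => (0 : ℝ)) fun t ht => hzero t fun h => ?_]
      · simp
      · exact absurd (h.1.trans ht.2) (not_le.2 (max_lt ha0 hs))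
    · have hab : a ≤ b := (ha hbK)
      have hall := intervalIntegral.integral_of_le (μ := volume) (f := ψ)
        (ha0.le.trans (hab.trans hs.le))
      rw [hall]
      refine Eq.trans ?_ h0
      exact setIntegral_eq_integral_of_forall_compl_eq_zero fun t ht => hzero t fun h =>
        ht ⟨ha0.trans_le h.1, h.2.trans hs.le⟩
  refine ⟨_, ⟨?_, HasCompactSupport.intro isCompact_Icc hprim, ?_⟩, hderiv⟩
  · rw [contDiff_infty_iff_deriv, hderiv]
    exact ⟨fun s => (hd s).differentiableAt, hψ.1⟩
  · refine (closure_minimal (fun s hs => ?_) isClosed_Icc).trans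
      (Icc_subset_Ioo (hK01 haK).1 (hK01 hbK).2)
    by_contra hn
    exact hs (hprim s hn)

theorem exists_isTestFunction_integral_eq_one : ∃ ρ, IsTestFunction ρ ∧ ∫ s, ρ s = 1 := by
  let b : ContDiffBump (1 / 2 : ℝ) := ⟨1 / 8, 1 / 4, by norm_num, by norm_num⟩
  refine ⟨b.normed volume, ⟨b.contDiff_normed, b.hasCompactSupport_normed, ?_⟩, b.integral_normed⟩
  rw [b.tsupport_normed_eq, Real.closedBall_eq_Icc]
  exact Icc_subset_Ioo (by norm_num [b]) (by norm_num [b])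

/-- The lemma of du Bois-Reymond: a function with vanishing weak derivative is constant. -/
theorem exists_ae_eq_const_of_integral_mul_deriv_eq_zero {w : ℝ → ℝ}
    (hw : IntegrableOn w (Ioo 0 1))
    (h : ∀ φ, IsTestFunction φ → ∫ s in Ioo (0 : ℝ) 1, w s * deriv φ s = 0) :
    ∃ c, ∀ᵐ s ∂(volume.restrict (Ioo (0 : ℝ) 1)), w s = c := by
  obtain ⟨ρ, hρ, hρ1⟩ := exists_isTestFunction_integral_eq_one
  have hint : ∀ φ, IsTestFunction φ → IntegrableOn (fun s => w s * φ s) (Ioo 0 1) := by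
    intro φ hφ
    obtain ⟨C, hC⟩ := hφ.1.continuous.bounded_above_of_compact_support hφ.2.1
    exact hw.mul_bdd (c := C) hφ.1.continuous.aestronglyMeasurable (ae_of_all _ hC)
  refine ⟨∫ s in Ioo (0 : ℝ) 1, w s * ρ s, ?_⟩
  set c := ∫ s in Ioo (0 : ℝ) 1, w s * ρ s with hc
  have hwc : IntegrableOn (fun s => w s - c) (Ioo 0 1) := hw.sub (integrable_const c)
  have := isOpen_Ioo.ae_eq_zero_of_integral_contDiff_smul_eq_zero (f := fun s => w s - c)
    (μ := volume) (U := Ioo (0 : ℝ) 1) hwc.locallyIntegrableOn fun g hg1 hg2 hg3 => by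
      have hg : IsTestFunction g := ⟨hg1, hg2, hg3⟩
      have hψ := hg.sub_const_mul hρ (∫ s, g s)
      obtain ⟨φ, hφ, hφ'⟩ := hψ.exists_deriv_eq (by
        rw [integral_sub hg.integrable (hρ.integrable.const_mul _), integral_const_mul, hρ1,
          mul_one, sub_self])
      have h0 := h φ hφ
      rw [hφ'] at h0
      simp only [mul_sub, mul_left_comm (w _)] at h0
      rw [integral_sub (hint g hg) ((hint ρ hρ).const_mul _), integral_const_mul, ← hc] at h0
      have e1 : ∫ s, g s • (w s - c) = ∫ s in Ioo (0 : ℝ) 1, (w s - c) * g s := by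
        rw [hg.setIntegral_mul]
        simp only [smul_eq_mul, mul_comm]
      have e2 : ∫ s, g s = ∫ s in Ioo (0 : ℝ) 1, g s := by
        simpa using (hg.setIntegral_mul fun _ => 1).symm
      rw [e1]
      simp only [sub_mul]
      rw [integral_sub (hint g hg) ((hg.integrable.integrableOn).const_mul _), integral_const_mul,
        ← e2]
      linarith
  rw [ae_restrict_iff' measurableSet_Ioo]
  filter_upwards [this] with s hs hs'
  linarith [hs hs']

/-- Integration by parts: `f` is the weak derivative of its primitive. -/
theorem integral_mul_eq_neg_integral_primitiveF_mul_deriv {f φ : ℝ → ℝ}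
    (hf : IntervalIntegrable f volume 0 1) (hφ : IsTestFunction φ) :
    ∫ s in Ioo (0 : ℝ) 1, f s * φ s = -∫ s in Ioo (0 : ℝ) 1, primitiveF f s * deriv φ s := by
  have hF : AbsolutelyContinuousOnInterval (primitiveF f) 0 1 :=
    hf.absolutelyContinuousOnInterval_intervalIntegral (by simp)
  have hφ' : AbsolutelyContinuousOnInterval φ 0 1 :=
    (hφ.1.of_le (by norm_cast)).contDiffOn.absolutelyContinuousOnInterval
  have h := hF.integral_mul_deriv_eq_deriv_mul hφ'
  rw [hφ.eq_zero (s := 0) (by simp), hφ.eq_zero (s := 1) (by simp)] at h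
  have hcongr : ∫ s in (0 : ℝ)..1, deriv (primitiveF f) s * φ s
      = ∫ s in (0 : ℝ)..1, f s * φ s := by
    refine intervalIntegral.integral_congr_ae ?_
    filter_upwards [hf.ae_hasDerivAt_integral] with s hs hs'
    have hFs : HasDerivAt (primitiveF f) (f s) s := hs (uIoc_subset_uIcc hs') 0 (by simp)
    rw [hFs.deriv]
  rw [hcongr] at h
  simp only [intervalIntegral.integral_of_le zero_le_one, integral_Ioc_eq_integral_Ioo] at h
  linarith

theorem continuousOn_primitiveF {f : ℝ → ℝ} (hf : IntervalIntegrable f volume 0 1) :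
    ContinuousOn (primitiveF f) (Icc 0 1) := by
  have := (hf.absolutelyContinuousOnInterval_intervalIntegral (c := 0) (by simp)).continuousOn
  rwa [uIcc_of_le zero_le_one] at this

/-- A continuous function that vanishes at `0` is the primitive of its weak derivative. -/
theorem IsWeakDeriv.eqOn_primitiveF {u v : ℝ → ℝ} (h : IsWeakDeriv u v)
    (hu : ContinuousOn u (Icc 0 1)) (hu0 : u 0 = 0) (hv : IntervalIntegrable v volume 0 1) :
    EqOn u (primitiveF v) (Icc 0 1) := by
  have hV := continuousOn_primitiveF hv
  have hint : ∀ {w φ : ℝ → ℝ}, ContinuousOn w (Icc 0 1) → IsTestFunction φ →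
      IntegrableOn (fun s => w s * deriv φ s) (Ioo 0 1) := fun hw hφ =>
    ((hw.mul (hφ.1.continuous_deriv (by norm_cast)).continuousOn).integrableOn_Icc).mono_set
      Ioo_subset_Icc_self
  obtain ⟨d, hd⟩ := exists_ae_eq_const_of_integral_mul_deriv_eq_zero
    (w := fun s => u s - primitiveF v s)
    (((hu.sub hV).integrableOn_Icc).mono_set Ioo_subset_Icc_self) fun φ hφ => by
      simp only [sub_mul]
      rw [integral_sub (hint hu hφ) (hint hV hφ), h φ hφ,
        integral_mul_eq_neg_integral_primitiveF_mul_deriv hv hφ, neg_neg, sub_self]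
  have heq : EqOn (fun s => u s - primitiveF v s) (fun _ => d) (Icc 0 1) := by
    refine Measure.eqOn_Icc_of_ae_eq (μ := volume) zero_ne_one ?_ (hu.sub hV) continuousOn_const
    rw [← restrict_Ioo_eq_restrict_Icc]
    exact hd
  have hd0 : u 0 - primitiveF v 0 = d := heq (by simp)
  intro s hs
  have hds : u s - primitiveF v s = d := heq hs
  simp only [primitiveF, intervalIntegral.integral_same, hu0, sub_zero] at hd0
  linarith

/-! ### The solution of the boundary value problem -/

section Solution

variable {A f : ℝ → ℝ} {ν₁ ν₂ x : ℝ}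

theorem memLp_two_intervalIntegrable (hf : MemLp f 2 (volume.restrict (Ioo (0 : ℝ) 1))) :
    IntervalIntegrable f volume 0 1 := by
  rw [intervalIntegrable_iff_integrableOn_Ioo_of_le zero_le_one]
  exact hf.integrable one_le_two

theorem intervalIntegral_indicator_Ioo_div (hx : x ∈ Ioo (0 : ℝ) 1) (h A : ℝ → ℝ) :
    ∫ s in (0 : ℝ)..1, (Ioo 0 x).indicator h s / A s = ∫ s in (0 : ℝ)..x, h s / A s := by
  have : (fun s => (Ioo 0 x).indicator h s / A s) = (Ioo 0 x).indicator fun s => h s / A s := by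
    ext s
    by_cases hs : s ∈ Ioo 0 x <;> simp [hs]
  rw [this, intervalIntegral.integral_of_le zero_le_one, intervalIntegral.integral_of_le hx.1.le,
    setIntegral_indicator measurableSet_Ioo, integral_Ioc_eq_integral_Ioo,
    inter_eq_self_of_subset_right (Ioo_subset_Ioc_self.trans (Ioc_subset_Ioc_right hx.2.le))]

theorem Zvec_zero (hx : x ∈ Ioo (0 : ℝ) 1) :
    Zvec f x A 0 = ∫ s in (0 : ℝ)..x, primitiveF f s / A s :=
  intervalIntegral_indicator_Ioo_div hx _ _

theorem Zvec_one : Zvec f x A 1 = ∫ s in (0 : ℝ)..1, primitiveF f s / A s := rfl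

theorem Zvec_two (hx : x ∈ Ioo (0 : ℝ) 1) : Zvec f x A 2 = ∫ s in (0 : ℝ)..x, 1 / A s :=
  intervalIntegral_indicator_Ioo_div hx _ _

theorem Zvec_three : Zvec f x A 3 = ∫ s in (0 : ℝ)..1, 1 / A s := rfl

section

variable (hν₁ : 0 < ν₁) (hAm : AEStronglyMeasurable A (volume.restrict (Ioo (0 : ℝ) 1)))
  (hA : ∀ s ∈ Icc (0 : ℝ) 1, ν₁ ≤ A s ∧ A s ≤ ν₂)

include hν₁ hAm hA

theorem intervalIntegrable_div {h : ℝ → ℝ} (hh : IntervalIntegrable h volume 0 1) :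
    IntervalIntegrable (fun s => h s / A s) volume 0 1 := by
  rw [intervalIntegrable_iff_integrableOn_Ioo_of_le zero_le_one] at hh ⊢
  simp only [div_eq_mul_inv]
  refine hh.mul_bdd (c := ν₁⁻¹) hAm.aemeasurable.inv.aestronglyMeasurable ?_
  filter_upwards [ae_restrict_mem measurableSet_Ioo] with s hs
  have h1 := hA s (Ioo_subset_Icc_self hs)
  rw [norm_inv, Real.norm_of_nonneg (hν₁.le.trans h1.1)]
  exact inv_anti₀ hν₁ h1.1

theorem le_intervalIntegral_one_div {y : ℝ} (hy : y ∈ Icc (0 : ℝ) 1) :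
    y / ν₂ ≤ ∫ s in (0 : ℝ)..y, 1 / A s := by
  have h1 := (intervalIntegrable_div hν₁ hAm hA (intervalIntegrable_const (c := (1 : ℝ)))).mono_set
    (by rw [uIcc_of_le hy.1, uIcc_of_le zero_le_one]; exact Icc_subset_Icc_right hy.2 :
      uIcc 0 y ⊆ uIcc 0 1)
  have h2 : ∫ _ in (0 : ℝ)..y, 1 / ν₂ = y / ν₂ := by
    rw [intervalIntegral.integral_const, smul_eq_mul, sub_zero, mul_one_div]
  rw [← h2]
  refine intervalIntegral.integral_mono_on hy.1 intervalIntegrable_const h1 fun s hs => ?_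
  have h3 := hA s ⟨hs.1, hs.2.trans hy.2⟩
  exact one_div_le_one_div_of_le (hν₁.trans_le h3.1) h3.2

/-- The solution of the boundary value problem at `x` in terms of the oscillatory integrals: the
flux `A u'` is `c - F`, where the constant `c` is determined by `u 1 = 0`. -/
theorem IsWeakSolution.apply_eq_gMap {u : ℝ → ℝ} (hu : IsWeakSolution A f u)
    (hf : IntervalIntegrable f volume 0 1) (hx : x ∈ Ioo (0 : ℝ) 1) :
    u x = gMap (Zvec f x A) := by
  obtain ⟨huc, hu0, hu1, v, hv2, hweak, hflux⟩ := hu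
  have hv := memLp_two_intervalIntegrable hv2
  have hFc := continuousOn_primitiveF hf
  have hF : IntervalIntegrable (primitiveF f) volume 0 1 :=
    ContinuousOn.intervalIntegrable (by rwa [uIcc_of_le zero_le_one])
  have hF' : IntegrableOn (primitiveF f) (Ioo 0 1) :=
    hFc.integrableOn_Icc.mono_set Ioo_subset_Icc_self
  have hprim := hweak.eqOn_primitiveF huc hu0 hv
  have hν₂ : ∀ s ∈ Icc (0 : ℝ) 1, 0 < A s := fun s hs => hν₁.trans_le (hA s hs).1
  have hAv : IntegrableOn (fun s => A s * v s) (Ioo 0 1) := by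
    refine (hv2.integrable one_le_two).bdd_mul (c := ν₂) hAm ?_
    filter_upwards [ae_restrict_mem measurableSet_Ioo] with s hs
    rw [Real.norm_of_nonneg (hν₂ s (Ioo_subset_Icc_self hs)).le]
    exact (hA s (Ioo_subset_Icc_self hs)).2
  have hbd : ∀ {w : ℝ → ℝ} {φ : ℝ → ℝ}, IntegrableOn w (Ioo 0 1) → IsTestFunction φ →
      IntegrableOn (fun s => w s * deriv φ s) (Ioo 0 1) := by
    intro w φ hw hφ
    obtain ⟨C, hC⟩ := (hφ.1.continuous_deriv (by norm_cast)).bounded_above_of_compact_support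
      hφ.2.1.deriv
    exact hw.mul_bdd (c := C) (hφ.1.continuous_deriv (by norm_cast)).aestronglyMeasurable
      (ae_of_all _ hC)
  obtain ⟨c, hc⟩ := exists_ae_eq_const_of_integral_mul_deriv_eq_zero
    (w := fun s => A s * v s + primitiveF f s) (hAv.add hF') fun φ hφ => by
      simp only [add_mul]
      rw [integral_add (hbd hAv hφ) (hbd hF' hφ), hflux φ hφ,
        integral_mul_eq_neg_integral_primitiveF_mul_deriv hf hφ, neg_add_cancel]
  have h1A := intervalIntegrable_div hν₁ hAm hA (intervalIntegrable_const (c := (1 : ℝ)))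
  have hFA := intervalIntegrable_div hν₁ hAm hA hF
  have hsol : ∀ y ∈ Icc (0 : ℝ) 1, u y =
      c * (∫ s in (0 : ℝ)..y, 1 / A s) - ∫ s in (0 : ℝ)..y, primitiveF f s / A s := by
    intro y hy
    have hsub : uIcc 0 y ⊆ uIcc 0 1 := by
      rw [uIcc_of_le hy.1, uIcc_of_le zero_le_one]
      exact Icc_subset_Icc_right hy.2
    rw [hprim hy, primitiveF, ← intervalIntegral.integral_const_mul,
      ← intervalIntegral.integral_sub ((h1A.mono_set hsub).const_mul c) (hFA.mono_set hsub)]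
    rw [intervalIntegral.integral_of_le hy.1, intervalIntegral.integral_of_le hy.1,
      integral_Ioc_eq_integral_Ioo, integral_Ioc_eq_integral_Ioo]
    refine integral_congr_ae ?_
    have hle : volume.restrict (Ioo 0 y) ≤ volume.restrict (Ioo (0 : ℝ) 1) :=
      Measure.restrict_mono (Ioo_subset_Ioo_right hy.2) le_rfl
    filter_upwards [ae_mono hle hc, ae_mono hle (ae_restrict_mem measurableSet_Ioo)] with s hs hs'
    have := (hν₂ s (Ioo_subset_Icc_self hs')).ne'
    field_simp
    linarith
  have hpos : 0 < ∫ s in (0 : ℝ)..1, 1 / A s := by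
    have h2 : 0 < ν₂ := (hν₂ 0 (by simp)).trans_le (hA 0 (by simp)).2
    exact (by positivity : 0 < 1 / ν₂).trans_le (le_intervalIntegral_one_div hν₁ hAm hA (by simp))
  have h1 := hsol 1 (by simp)
  have hcx : c = (∫ s in (0 : ℝ)..1, primitiveF f s / A s) / ∫ s in (0 : ℝ)..1, 1 / A s := by
    rw [eq_div_iff hpos.ne']
    linarith
  rw [hsol x (Ioo_subset_Icc_self hx), gMap, Zvec_zero hx, Zvec_one, Zvec_two hx, Zvec_three, hcx]
  ring

end

end Solution


/-! ### Smoothness of parametric integrals -/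

section ParametricIntegral

variable {S : Type*} [MeasurableSpace S]

/-- A measurable family `(K s)` of continuous functions that is bounded on bounded sets, uniformly
in the parameter `s`. -/
structure IsLocallyUniformlyBounded (K : S → ℝ → ℝ) : Prop where
  measurable : Measurable (Function.uncurry K)
  continuous : ∀ s, Continuous (K s)
  exists_bound : ∀ R : ℝ, ∃ C : ℝ, ∀ s τ, |τ| ≤ R → |K s τ| ≤ C

/-- The derivatives of `K s` up to order `n` are bounded on bounded sets, uniformly in `s`. -/
def HasLocallyBoundedDerivs : ℕ → (S → ℝ → ℝ) → Prop
  | 0, K => IsLocallyUniformlyBounded K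
  | n + 1, K => IsLocallyUniformlyBounded K ∧
      ∃ K' : S → ℝ → ℝ, HasLocallyBoundedDerivs n K' ∧ ∀ s τ, HasDerivAt (K s) (K' s τ) τ

theorem IsLocallyUniformlyBounded.mul {K L : S → ℝ → ℝ} (hK : IsLocallyUniformlyBounded K)
    (hL : IsLocallyUniformlyBounded L) : IsLocallyUniformlyBounded fun s τ => K s τ * L s τ where
  measurable := hK.measurable.mul hL.measurable
  continuous s := (hK.continuous s).mul (hL.continuous s)
  exists_bound R := by
    obtain ⟨C, hC⟩ := hK.exists_bound R
    obtain ⟨D, hD⟩ := hL.exists_bound R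
    refine ⟨C * D, fun s τ hτ => ?_⟩
    rw [abs_mul]
    exact mul_le_mul (hC s τ hτ) (hD s τ hτ) (abs_nonneg _) ((abs_nonneg _).trans (hC s τ hτ))

theorem IsLocallyUniformlyBounded.add {K L : S → ℝ → ℝ} (hK : IsLocallyUniformlyBounded K)
    (hL : IsLocallyUniformlyBounded L) : IsLocallyUniformlyBounded fun s τ => K s τ + L s τ where
  measurable := hK.measurable.add hL.measurable
  continuous s := (hK.continuous s).add (hL.continuous s)
  exists_bound R := by
    obtain ⟨C, hC⟩ := hK.exists_bound R
    obtain ⟨D, hD⟩ := hL.exists_bound R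
    exact ⟨C + D, fun s τ hτ => (abs_add_le _ _).trans (add_le_add (hC s τ hτ) (hD s τ hτ))⟩

theorem IsLocallyUniformlyBounded.neg {K : S → ℝ → ℝ} (hK : IsLocallyUniformlyBounded K) :
    IsLocallyUniformlyBounded fun s τ => -K s τ where
  measurable := hK.measurable.neg
  continuous s := (hK.continuous s).neg
  exists_bound R := by simpa only [abs_neg] using hK.exists_bound R

namespace HasLocallyBoundedDerivs

theorem isLocallyUniformlyBounded {n : ℕ} {K : S → ℝ → ℝ} (h : HasLocallyBoundedDerivs n K) :
    IsLocallyUniformlyBounded K := by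
  cases n with
  | zero => exact h
  | succ n => exact h.1

theorem of_succ {n : ℕ} : ∀ {K : S → ℝ → ℝ}, HasLocallyBoundedDerivs (n + 1) K →
    HasLocallyBoundedDerivs n K := by
  induction n with
  | zero => exact fun h => h.1
  | succ n ih =>
    rintro K ⟨h, K', hK', hd⟩
    exact ⟨h, K', ih hK', hd⟩

theorem neg {n : ℕ} : ∀ {K : S → ℝ → ℝ}, HasLocallyBoundedDerivs n K →
    HasLocallyBoundedDerivs n fun s τ => -K s τ := by
  induction n with
  | zero => exact fun hK => IsLocallyUniformlyBounded.neg hK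
  | succ n ih =>
    rintro K ⟨hK, K', hK', hKd⟩
    exact ⟨hK.neg, _, ih hK', fun s τ => (hKd s τ).neg⟩

theorem add {n : ℕ} : ∀ {K L : S → ℝ → ℝ}, HasLocallyBoundedDerivs n K →
    HasLocallyBoundedDerivs n L → HasLocallyBoundedDerivs n fun s τ => K s τ + L s τ := by
  induction n with
  | zero => exact fun hK hL => IsLocallyUniformlyBounded.add hK hL
  | succ n ih =>
    rintro K L ⟨hK, K', hK', hKd⟩ ⟨hL, L', hL', hLd⟩
    exact ⟨hK.add hL, _, ih hK' hL', fun s τ => (hKd s τ).add (hLd s τ)⟩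

theorem mul {n : ℕ} : ∀ {K L : S → ℝ → ℝ}, HasLocallyBoundedDerivs n K →
    HasLocallyBoundedDerivs n L → HasLocallyBoundedDerivs n fun s τ => K s τ * L s τ := by
  induction n with
  | zero => exact fun hK hL => IsLocallyUniformlyBounded.mul hK hL
  | succ n ih =>
    intro K L hK hL
    have hK0 := hK.of_succ
    have hL0 := hL.of_succ
    obtain ⟨hK, K', hK', hKd⟩ := hK
    obtain ⟨hL, L', hL', hLd⟩ := hL
    exact ⟨hK.mul hL, _, (ih hK' hL0).add (ih hK0 hL'), fun s τ => (hKd s τ).mul (hLd s τ)⟩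

end HasLocallyBoundedDerivs

universe u

variable {E : Type u} [NormedAddCommGroup E] [InnerProductSpace ℝ E] {μ : Measure S}
  [IsFiniteMeasure μ] {H : S → E} {B : ℝ}

theorem IsLocallyUniformlyBounded.integrable {F : Type*} [NormedAddCommGroup F] [NormedSpace ℝ F]
    {K : S → ℝ → ℝ} (hK : IsLocallyUniformlyBounded K) (hH : StronglyMeasurable H)
    (hB : ∀ s, ‖H s‖ ≤ B) {w : S → F} {D : ℝ} (hw : StronglyMeasurable w) (hD : ∀ s, ‖w s‖ ≤ D)
    (l : E) : Integrable (fun s => K s (inner ℝ l (H s)) • w s) μ := by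
  obtain ⟨C, hC⟩ := hK.exists_bound (‖l‖ * B)
  have hin : Measurable fun s => inner ℝ l (H s) := (stronglyMeasurable_const.inner hH).measurable
  refine Integrable.of_bound (C := C * D) ?_ (ae_of_all _ fun s => ?_)
  · exact ((hK.measurable.comp (measurable_id.prodMk hin)).stronglyMeasurable.smul
      hw).aestronglyMeasurable
  · have h1 := hC s (inner ℝ l (H s)) ((abs_real_inner_le_norm _ _).trans (by gcongr; exact hB s))
    rw [norm_smul, Real.norm_eq_abs]
    exact mul_le_mul h1 (hD s) (norm_nonneg _) ((abs_nonneg _).trans h1)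

/-- Differentiation under the integral sign. The vector-valued weight `w` makes the induction on the
order work: a derivative in `l` multiplies it by the linear form `m ↦ m · H s`. -/
theorem HasLocallyBoundedDerivs.contDiff_integral (hH : StronglyMeasurable H)
    (hB : ∀ s, ‖H s‖ ≤ B) (n : ℕ) : ∀ {F : Type u} [NormedAddCommGroup F] [NormedSpace ℝ F]
    {K : S → ℝ → ℝ} {w : S → F} {D : ℝ}, HasLocallyBoundedDerivs n K → StronglyMeasurable w →
    (∀ s, ‖w s‖ ≤ D) → ContDiff ℝ n fun l : E => ∫ s, K s (inner ℝ l (H s)) • w s ∂μ := by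
  induction n with
  | zero =>
    intro F _ _ K w D hK hw hD
    have hK : IsLocallyUniformlyBounded K := hK
    rw [Nat.cast_zero, contDiff_zero, continuous_iff_continuousAt]
    intro l₀
    obtain ⟨C, hC⟩ := hK.exists_bound ((‖l₀‖ + 1) * B)
    refine continuousAt_of_dominated (bound := fun _ => C * D)
      (Eventually.of_forall fun l => (hK.integrable hH hB hw hD l).aestronglyMeasurable) ?_
      (integrable_const _) (ae_of_all _ fun s => ?_)
    · filter_upwards [Metric.ball_mem_nhds l₀ one_pos] with l hl
      refine ae_of_all _ fun s => ?_
      have hl' : ‖l‖ ≤ ‖l₀‖ + 1 := by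
        have := norm_le_norm_add_norm_sub' l l₀
        rw [Metric.mem_ball, dist_eq_norm] at hl
        linarith
      have h1 := hC s (inner ℝ l (H s))
        ((abs_real_inner_le_norm _ _).trans (by gcongr; exact hB s))
      rw [norm_smul, Real.norm_eq_abs]
      exact mul_le_mul h1 (hD s) (norm_nonneg _) ((abs_nonneg _).trans h1)
    · have := hK.continuous s
      fun_prop
  | succ n ih =>
    rintro F _ _ K w D ⟨hK, K', hK', hd⟩ hw hD
    have hK'0 := hK'.isLocallyUniformlyBounded
    -- the derivative of the integrand in direction `m` is `K' s (l · H s) (m · H s) w s`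
    set w' : S → E →L[ℝ] F := fun s => (innerSL ℝ (H s)).smulRight (w s) with hw'
    have hw'm : StronglyMeasurable w' :=
      isBoundedBilinearMap_smulRight.continuous.comp_stronglyMeasurable
        (((innerSL ℝ (E := E)).continuous.comp_stronglyMeasurable hH).prodMk hw)
    have hw'D : ∀ s, ‖w' s‖ ≤ B * D := fun s => by
      rw [hw', ContinuousLinearMap.norm_smulRight_apply, innerSL_apply_norm]
      exact mul_le_mul (hB s) (hD s) (norm_nonneg _) ((norm_nonneg _).trans (hB s))
    rw [Nat.cast_succ, contDiff_succ_iff_hasFDerivAt]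
    refine ⟨fun l => ∫ s, K' s (inner ℝ l (H s)) • w' s ∂μ, ih hK' hw'm hw'D, fun l₀ => ?_⟩
    obtain ⟨C, hC⟩ := hK'0.exists_bound ((‖l₀‖ + 1) * B)
    refine hasFDerivAt_integral_of_dominated_of_fderiv_le (bound := fun _ => C * (B * D))
      (F' := fun l s => K' s (inner ℝ l (H s)) • w' s)
      (Metric.ball_mem_nhds l₀ one_pos)
      (Eventually.of_forall fun l => (hK.integrable hH hB hw hD l).aestronglyMeasurable)
      (hK.integrable hH hB hw hD l₀) (hK'0.integrable hH hB hw'm hw'D l₀).aestronglyMeasurable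
      (ae_of_all _ fun s l hl => ?_) (integrable_const _) (ae_of_all _ fun s l _ => ?_)
    · have hl' : ‖l‖ ≤ ‖l₀‖ + 1 := by
        have := norm_le_norm_add_norm_sub' l l₀
        rw [Metric.mem_ball, dist_eq_norm] at hl
        linarith
      have h1 := hC s (inner ℝ l (H s))
        ((abs_real_inner_le_norm _ _).trans (by gcongr; exact hB s))
      rw [norm_smul, Real.norm_eq_abs]
      exact mul_le_mul h1 (hw'D s) (norm_nonneg _) ((abs_nonneg _).trans h1)
    · have hin : HasFDerivAt (fun l : E => inner ℝ l (H s)) (innerSL ℝ (H s)) l := by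
        refine ((innerSL ℝ (H s)).hasFDerivAt (x := l)).congr_of_eventuallyEq
          (Eventually.of_forall fun m => ?_)
        rw [innerSL_apply_apply, real_inner_comm]
      refine (((hd s _).comp_hasFDerivAt l hin).smul_const (w s)).congr_fderiv ?_
      ext m
      simp [hw', mul_smul]

end ParametricIntegral

/-! ### The integrated cumulant generating function -/

section Cumulant

variable {S T : Type*} [MeasurableSpace S] [MeasurableSpace T] {π : Measure T}
  [IsProbabilityMeasure π] {V : S → T → ℝ} {C : ℝ}

theorem integrable_exp_mul_of_ae_abs_le {X : T → ℝ} (hX : AEMeasurable X π)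
    (hC : ∀ᵐ t ∂π, |X t| ≤ C) (τ : ℝ) : Integrable (fun t => Real.exp (τ * X t)) π :=
  integrable_exp_mul_of_mem_Icc hX (hC.mono fun _ ht => abs_le.1 ht)

theorem abs_cgf_le {X : T → ℝ} (hX : AEMeasurable X π) (hC : ∀ᵐ t ∂π, |X t| ≤ C) (τ : ℝ) :
    |cgf X π τ| ≤ |τ| * C := by
  have hint := integrable_exp_mul_of_ae_abs_le hX hC τ
  have hbd : ∀ᵐ t ∂π, |τ * X t| ≤ |τ| * C := hC.mono fun t ht => by
    rw [abs_mul]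
    gcongr
  rw [abs_le, cgf, Real.le_log_iff_exp_le (mgf_pos hint), Real.log_le_iff_le_exp (mgf_pos hint)]
  constructor
  · have := integral_mono_ae (integrable_const (Real.exp (-(|τ| * C)))) hint
      (hbd.mono fun t ht => Real.exp_le_exp.2 (abs_le.1 ht).1)
    simpa [mgf] using this
  · have := integral_mono_ae hint (integrable_const (Real.exp (|τ| * C)))
      (hbd.mono fun t ht => Real.exp_le_exp.2 (abs_le.1 ht).2)
    simpa [mgf] using this

theorem convexOn_cgf_of_ae_abs_le {X : T → ℝ} (hX : AEMeasurable X π)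
    (hC : ∀ᵐ t ∂π, |X t| ≤ C) : ConvexOn ℝ univ (cgf X π) := by
  have hset : ∀ τ, τ ∈ interior (integrableExpSet X π) := fun τ => by
    rw [show integrableExpSet X π = univ from
      eq_univ_of_forall fun τ => integrable_exp_mul_of_ae_abs_le hX hC τ]
    simp
  have han : ∀ τ, AnalyticAt ℝ (cgf X π) τ := fun τ => analyticAt_cgf (hset τ)
  refine convexOn_univ_of_deriv2_nonneg (fun τ => (han τ).differentiableAt)
    (fun τ => (han τ).deriv.differentiableAt) fun τ => ?_
  rw [← iteratedDeriv_eq_iterate, iteratedDeriv_two_cgf_eq_integral (hset τ)]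
  exact div_nonneg (integral_nonneg fun t => by positivity) mgf_nonneg

variable (hV : Measurable (Function.uncurry V)) (hC : ∀ᵐ t ∂π, ∀ s, |V s t| ≤ C)

include hV hC

/-- The tilted moments `R k = 𝔼[V ^ k exp (τ V)] / 𝔼[exp (τ V)]` satisfy `R k' = R (k + 1) - R k R 1`,
which bounds all their derivatives. -/
theorem hasLocallyBoundedDerivs_moment_ratio (n : ℕ) : ∀ k : ℕ, HasLocallyBoundedDerivs n
    fun s τ => (∫ t, V s t ^ k * Real.exp (τ * V s t) ∂π) / mgf (V s) π τ := by
  have hVs : ∀ s, AEMeasurable (V s) π := fun s => (hV.comp measurable_prodMk_left).aemeasurable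
  have hCs : ∀ s, ∀ᵐ t ∂π, |V s t| ≤ C := fun s => hC.mono fun t ht => ht s
  have hset : ∀ s τ, τ ∈ interior (integrableExpSet (V s) π) := fun s τ => by
    rw [show integrableExpSet (V s) π = univ from
      eq_univ_of_forall fun τ => integrable_exp_mul_of_ae_abs_le (hVs s) (hCs s) τ]
    simp
  have hpos : ∀ s τ, 0 < mgf (V s) π τ := fun s τ =>
    mgf_pos (integrable_exp_mul_of_ae_abs_le (hVs s) (hCs s) τ)
  have hmom : ∀ k, Measurable (Function.uncurry fun s τ =>
      ∫ t, V s t ^ k * Real.exp (τ * V s t) ∂π) := fun k => by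
    refine StronglyMeasurable.measurable ?_
    refine StronglyMeasurable.integral_prod_right'
      (f := fun p : (S × ℝ) × T => V p.1.1 p.2 ^ k * Real.exp (p.1.2 * V p.1.1 p.2)) ?_
    have h1 : Measurable fun p : (S × ℝ) × T => V p.1.1 p.2 :=
      hV.comp (measurable_fst.fst.prodMk measurable_snd)
    exact (by fun_prop : Measurable _).stronglyMeasurable
  have hderiv : ∀ k s τ, HasDerivAt
      (fun τ => (∫ t, V s t ^ k * Real.exp (τ * V s t) ∂π) / mgf (V s) π τ)
      ((∫ t, V s t ^ (k + 1) * Real.exp (τ * V s t) ∂π) / mgf (V s) π τ +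
        -((∫ t, V s t ^ k * Real.exp (τ * V s t) ∂π) / mgf (V s) π τ *
          ((∫ t, V s t ^ 1 * Real.exp (τ * V s t) ∂π) / mgf (V s) π τ))) τ := fun k s τ => by
    refine ((hasDerivAt_integral_pow_mul_exp_real (hset s τ) k).div (hasDerivAt_mgf (hset s τ))
      (hpos s τ).ne').congr_deriv ?_
    have := (hpos s τ).ne'
    simp only [pow_one]
    field_simp
    ring
  have h0 : ∀ k, IsLocallyUniformlyBounded
      fun s τ => (∫ t, V s t ^ k * Real.exp (τ * V s t) ∂π) / mgf (V s) π τ := fun k => by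
    refine ⟨?_, fun s => continuous_iff_continuousAt.2 fun τ => (hderiv k s τ).continuousAt,
      fun R => ⟨C ^ k, fun s τ hτ => ?_⟩⟩
    · refine (hmom k).div ?_
      have h := hmom 0
      simp only [pow_zero, one_mul] at h
      exact h
    · rw [abs_div, abs_of_pos (hpos s τ), div_le_iff₀ (hpos s τ), mgf, ← integral_const_mul]
      refine (abs_integral_le_integral_abs).trans (integral_mono_of_nonneg
        (ae_of_all _ fun _ => abs_nonneg _)
        ((integrable_exp_mul_of_ae_abs_le (hVs s) (hCs s) τ).const_mul _) ?_)
      filter_upwards [hCs s] with t ht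
      rw [abs_mul, abs_pow, abs_of_pos (Real.exp_pos _)]
      gcongr
  induction n with
  | zero => exact h0
  | succ n ih => exact fun k => ⟨h0 k, _, (ih (k + 1)).add ((ih k).mul (ih 1)).neg, hderiv k⟩

theorem hasLocallyBoundedDerivs_cgf (n : ℕ) :
    HasLocallyBoundedDerivs n fun s τ => cgf (V s) π τ := by
  have hVs : ∀ s, AEMeasurable (V s) π := fun s => (hV.comp measurable_prodMk_left).aemeasurable
  have hCs : ∀ s, ∀ᵐ t ∂π, |V s t| ≤ C := fun s => hC.mono fun t ht => ht s
  have hset : ∀ s τ, τ ∈ interior (integrableExpSet (V s) π) := fun s τ => by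
    rw [show integrableExpSet (V s) π = univ from
      eq_univ_of_forall fun τ => integrable_exp_mul_of_ae_abs_le (hVs s) (hCs s) τ]
    simp
  have hderiv : ∀ s τ, HasDerivAt (cgf (V s) π)
      ((∫ t, V s t ^ 1 * Real.exp (τ * V s t) ∂π) / mgf (V s) π τ) τ := fun s τ => by
    simp only [pow_one]
    exact (hasDerivAt_mgf (hset s τ)).log
      (mgf_pos (integrable_exp_mul_of_ae_abs_le (hVs s) (hCs s) τ)).ne'
  have h0 : IsLocallyUniformlyBounded fun s τ => cgf (V s) π τ := by
    refine ⟨?_, fun s => continuous_iff_continuousAt.2 fun τ => (hderiv s τ).continuousAt,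
      fun R => ⟨R * C, fun s τ hτ => (abs_cgf_le (hVs s) (hCs s) τ).trans ?_⟩⟩
    · refine Measurable.log (StronglyMeasurable.measurable ?_)
      refine StronglyMeasurable.integral_prod_right'
        (f := fun p : (S × ℝ) × T => Real.exp (p.1.2 * V p.1.1 p.2)) ?_
      have h1 : Measurable fun p : (S × ℝ) × T => V p.1.1 p.2 :=
        hV.comp (measurable_fst.fst.prodMk measurable_snd)
      exact (by fun_prop : Measurable _).stronglyMeasurable
    · obtain ⟨t, ht⟩ := (hCs s).exists
      have : 0 ≤ C := (abs_nonneg _).trans ht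
      gcongr
  cases n with
  | zero => exact h0
  | succ n => exact ⟨h0, _, hasLocallyBoundedDerivs_moment_ratio hV hC n 1, hderiv⟩

variable {E : Type*} [NormedAddCommGroup E] [InnerProductSpace ℝ E] {μ : Measure S}
  [IsFiniteMeasure μ] {H : S → E} {B : ℝ} (hB : ∀ s, ‖H s‖ ≤ B)

include hB

theorem abs_integral_cgf_inner_le (hC0 : 0 ≤ C) (l : E) :
    |∫ s, cgf (V s) π (inner ℝ l (H s)) ∂μ| ≤ μ.real univ * (C * B) * ‖l‖ := by
  have := norm_integral_le_of_norm_le_const (μ := μ) (C := ‖l‖ * B * C)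
    (f := fun s => cgf (V s) π (inner ℝ l (H s))) (ae_of_all _ fun s => by
      rw [Real.norm_eq_abs]
      refine (abs_cgf_le (hV.comp measurable_prodMk_left).aemeasurable
        (hC.mono fun t ht => ht s) _).trans ?_
      gcongr
      exact (abs_real_inner_le_norm _ _).trans (by gcongr; exact hB s))
  rw [Real.norm_eq_abs] at this
  linarith

variable (hH : StronglyMeasurable H)

include hH

theorem integrable_cgf_inner (l : E) : Integrable (fun s => cgf (V s) π (inner ℝ l (H s))) μ := by
  simpa using (hasLocallyBoundedDerivs_cgf hV hC 0).isLocallyUniformlyBounded.integrable hH hB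
    (stronglyMeasurable_const (b := (1 : ℝ))) (fun _ => norm_one.le) l (μ := μ)

theorem convexOn_integral_cgf_inner :
    ConvexOn ℝ univ fun l : E => ∫ s, cgf (V s) π (inner ℝ l (H s)) ∂μ := by
  refine ⟨convex_univ, fun l₁ _ l₂ _ p q hp hq hpq => ?_⟩
  have hint := integrable_cgf_inner (μ := μ) hV hC hB hH
  simp only [smul_eq_mul]
  rw [← integral_const_mul, ← integral_const_mul,
    ← integral_add ((hint l₁).const_mul p) ((hint l₂).const_mul q)]
  refine integral_mono (hint _) (((hint l₁).const_mul p).add ((hint l₂).const_mul q)) fun s => ?_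
  have hs := (convexOn_cgf_of_ae_abs_le (X := V s) (hV.comp measurable_prodMk_left).aemeasurable
    (hC.mono fun t ht => ht s)).2 (mem_univ (inner ℝ l₁ (H s))) (mem_univ (inner ℝ l₂ (H s)))
    hp hq hpq
  simpa only [inner_add_left, inner_smul_left, conj_trivial, smul_eq_mul] using hs

end Cumulant

theorem contDiff_integral_cgf_inner {S T E : Type} [MeasurableSpace S] [MeasurableSpace T]
    {π : Measure T} [IsProbabilityMeasure π] {V : S → T → ℝ} {C : ℝ}
    (hV : Measurable (Function.uncurry V)) (hC : ∀ᵐ t ∂π, ∀ s, |V s t| ≤ C)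
    [NormedAddCommGroup E] [InnerProductSpace ℝ E] {μ : Measure S} [IsFiniteMeasure μ]
    {H : S → E} {B : ℝ} (hH : StronglyMeasurable H) (hB : ∀ s, ‖H s‖ ≤ B) :
    ContDiff ℝ (⊤ : ℕ∞) fun l : E => ∫ s, cgf (V s) π (inner ℝ l (H s)) ∂μ := by
  refine contDiff_infty.2 fun n => ?_
  have := (hasLocallyBoundedDerivs_cgf hV hC n).contDiff_integral (μ := μ) hH hB n
    (stronglyMeasurable_const (b := (1 : ℝ))) (fun _ => norm_one.le)
  simpa using this


/-! ### Cell averages -/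

section Cells

variable {G : Type*} [NormedAddCommGroup G] [NormedSpace ℝ G]

theorem floor_div_eq {ε s : ℝ} (hε : 0 < ε) {j : ℕ} (hs : s ∈ Ioo (ε * j) (ε * (j + 1))) :
    ⌊s / ε⌋₊ = j := by
  rw [Nat.floor_eq_iff (div_nonneg ((by positivity : 0 ≤ ε * j).trans hs.1.le) hε.le),
    le_div_iff₀' hε, div_lt_iff₀' hε]
  exact ⟨hs.1.le, hs.2⟩

theorem sum_integral_cells {ε : ℝ} (hε : 0 < ε) (F : ℕ → ℝ → G)
    (hF : ∀ a b, IntervalIntegrable (fun s => F ⌊s / ε⌋₊ s) volume a b) (N : ℕ) :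
    ∑ j ∈ Finset.range N, ∫ s in (ε * j)..(ε * (j + 1)), F j s =
      ∫ s in (0 : ℝ)..(ε * N), F ⌊s / ε⌋₊ s := by
  have h := intervalIntegral.sum_integral_adjacent_intervals (n := N) (μ := volume)
    (f := fun s => F ⌊s / ε⌋₊ s) (a := fun j : ℕ => ε * j) fun k _ => hF _ _
  simp only [Nat.cast_zero, mul_zero, Nat.cast_add, Nat.cast_one] at h
  rw [← h]
  refine Finset.sum_congr rfl fun j _ => ?_
  have hle : ε * j ≤ ε * (j + 1) := by gcongr; linarith
  rw [intervalIntegral.integral_of_le hle, intervalIntegral.integral_of_le hle,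
    integral_Ioc_eq_integral_Ioo, integral_Ioc_eq_integral_Ioo]
  exact setIntegral_congr_fun measurableSet_Ioo fun s hs => by rw [floor_div_eq hε hs]

/-- The average of `f` over the cell of length `ε` that contains `s` tends to `f s`. -/
theorem tendsto_cell_average {f : ℝ → G} [CompleteSpace G]
    (hf : ∀ a b, IntervalIntegrable f volume a b) {s : ℝ}
    (hs : 0 ≤ s) (hc : ContinuousAt f s) :
    Tendsto (fun ε : ℝ => ε⁻¹ • ∫ r in (ε * ⌊s / ε⌋₊)..(ε * (⌊s / ε⌋₊ + 1)), f r)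
      (𝓝[>] 0) (𝓝 (f s)) := by
  rw [Metric.tendsto_nhds]
  intro η hη
  obtain ⟨δ, hδ, hδf⟩ := Metric.continuousAt_iff.1 hc (η / 2) (by positivity)
  filter_upwards [self_mem_nhdsWithin, Ioo_mem_nhdsGT hδ] with ε hε hεδ
  have hε : (0 : ℝ) < ε := hε
  have h1 : ε * ⌊s / ε⌋₊ ≤ s := by
    rw [← le_div_iff₀' hε]
    exact Nat.floor_le (by positivity)
  have h2 : s < ε * (⌊s / ε⌋₊ + 1) := by
    rw [← div_lt_iff₀' hε]
    exact Nat.lt_floor_add_one _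
  have hsub : ε⁻¹ • (∫ r in (ε * ⌊s / ε⌋₊)..(ε * (⌊s / ε⌋₊ + 1)), f r) - f s
      = ε⁻¹ • ∫ r in (ε * ⌊s / ε⌋₊)..(ε * (⌊s / ε⌋₊ + 1)), (f r - f s) := by
    rw [intervalIntegral.integral_sub (hf _ _) intervalIntegrable_const,
      intervalIntegral.integral_const, smul_sub, smul_smul,
      show ε⁻¹ * (ε * ((⌊s / ε⌋₊ : ℝ) + 1) - ε * ⌊s / ε⌋₊) = 1 by field_simp; ring, one_smul]
  have hn := intervalIntegral.norm_integral_le_of_norm_le_const (C := η / 2)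
    (f := fun r => f r - f s) (a := ε * ⌊s / ε⌋₊) (b := ε * (⌊s / ε⌋₊ + 1)) fun r hr => by
      rw [uIoc_of_le (h1.trans h2.le)] at hr
      rw [← dist_eq_norm]
      refine (hδf ?_).le
      rw [Real.dist_eq, abs_lt]
      constructor <;> nlinarith [hr.1, hr.2, hεδ.2]
  rw [dist_eq_norm, hsub, norm_smul, Real.norm_of_nonneg (inv_pos.2 hε).le]
  rw [show ε * ((⌊s / ε⌋₊ : ℝ) + 1) - ε * ⌊s / ε⌋₊ = ε by ring, abs_of_pos hε] at hn
  calc _ ≤ ε⁻¹ * (η / 2 * ε) := by gcongr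
    _ = η / 2 := by field_simp
    _ < η := by linarith

end Cells

/-! ### Sums over cells of independent contributions -/

section CellSum

variable {T E : Type*} [MeasurableSpace T] [NormedAddCommGroup E] [InnerProductSpace ℝ E]

/-- The contribution of the `j`-th cell `[ε j, ε (j + 1)]`, for the value `t` of the random
parameter in this cell. -/
def cellIntegral (V : ℝ → T → ℝ) (H : ℝ → E) (ε : ℝ) (j : ℕ) (t : T) : E :=
  ∫ s in (ε * j)..(ε * (j + 1)), V s t • H s

/-- The sum of the contributions of the cells that meet `[0, 1)`. -/
def cellSum (V : ℝ → T → ℝ) (H : ℝ → E) (ε : ℝ) (t : ℕ → T) : E :=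
  ∑ j ∈ Finset.range ⌈ε⁻¹⌉₊, cellIntegral V H ε j (t j)

variable {V : ℝ → T → ℝ} {H : ℝ → E} {B C ε : ℝ}

theorem one_le_mul_ceil_inv (hε : 0 < ε) : 1 ≤ ε * ⌈ε⁻¹⌉₊ := by
  have := Nat.le_ceil ε⁻¹
  rwa [inv_le_iff_one_le_mul₀' hε] at this

omit [MeasurableSpace T] in
theorem norm_cellIntegral_le (hB : ∀ s, ‖H s‖ ≤ B) {t : T} (ht : ∀ s, |V s t| ≤ C) (hε : 0 < ε) (j : ℕ) :
    ‖cellIntegral V H ε j t‖ ≤ C * B * ε := by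
  have := intervalIntegral.norm_integral_le_of_norm_le_const (a := ε * j) (b := ε * (j + 1))
    (C := C * B) (f := fun s => V s t • H s) fun s _ => by
      rw [norm_smul, Real.norm_eq_abs]
      exact mul_le_mul (ht s) (hB s) (norm_nonneg _) ((abs_nonneg _).trans (ht s))
  rwa [show ε * ((j : ℝ) + 1) - ε * j = ε by ring, abs_of_pos hε] at this

variable (hV : Measurable (Function.uncurry V)) (hH : StronglyMeasurable H) (hB : ∀ s, ‖H s‖ ≤ B)

include hV hH hB

theorem intervalIntegrable_smul_floor {t : ℕ → T} (ht : ∀ j s, |V s (t j)| ≤ C) (a b : ℝ) :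
    IntervalIntegrable (fun s => V s (t ⌊s / ε⌋₊) • H s) volume a b := by
  have hm : Measurable fun s => V s (t ⌊s / ε⌋₊) :=
    hV.comp (measurable_id.prodMk ((measurable_from_nat (f := t)).comp
      (Nat.measurable_floor.comp (measurable_id.div_const ε))))
  refine (intervalIntegrable_const (c := C * B)).mono_fun
    (hm.stronglyMeasurable.smul hH).aestronglyMeasurable (ae_of_all _ fun s => ?_)
  simp only [norm_smul, Real.norm_eq_abs]
  refine le_trans (mul_le_mul (ht _ s) (hB s) (norm_nonneg _) ((abs_nonneg _).trans (ht 0 s))) ?_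
  exact le_abs_self _

theorem cellSum_eq_integral (hH1 : ∀ s, 1 ≤ s → H s = 0) {t : ℕ → T}
    (ht : ∀ j s, |V s (t j)| ≤ C) (hε : 0 < ε) :
    cellSum V H ε t = ∫ s in (0 : ℝ)..1, V s (t ⌊s / ε⌋₊) • H s := by
  have hint := intervalIntegrable_smul_floor (ε := ε) hV hH hB ht
  rw [cellSum]
  simp only [cellIntegral]
  rw [sum_integral_cells hε (fun j s => V s (t j) • H s) hint,
    ← intervalIntegral.integral_add_adjacent_intervals (hint 0 1) (hint 1 _), add_eq_left,
    intervalIntegral.integral_congr (g := fun _ => (0 : E)), intervalIntegral.integral_zero]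
  intro s hs
  rw [uIcc_of_le (one_le_mul_ceil_inv hε)] at hs
  simp [hH1 s hs.1]

theorem norm_cellSum_le (hH1 : ∀ s, 1 ≤ s → H s = 0) {t : ℕ → T}
    (ht : ∀ j s, |V s (t j)| ≤ C) (hε : 0 < ε) : ‖cellSum V H ε t‖ ≤ C * B := by
  rw [cellSum_eq_integral hV hH hB hH1 ht hε]
  have := intervalIntegral.norm_integral_le_of_norm_le_const (a := 0) (b := 1) (C := C * B)
    (f := fun s => V s (t ⌊s / ε⌋₊) • H s) fun s _ => by
      rw [norm_smul, Real.norm_eq_abs]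
      exact mul_le_mul (ht _ s) (hB s) (norm_nonneg _) ((abs_nonneg _).trans (ht 0 s))
  simpa using this

variable [MeasurableSpace E] [BorelSpace E]

omit hB in
theorem measurable_cellIntegral (hε : 0 < ε) (j : ℕ) : Measurable (cellIntegral V H ε j) := by
  have hle : ε * j ≤ ε * (j + 1) := by gcongr; linarith
  have : cellIntegral V H ε j = fun t => ∫ s in Ioc (ε * j) (ε * (j + 1)), V s t • H s := by
    ext1 t
    exact intervalIntegral.integral_of_le hle
  rw [this]
  refine StronglyMeasurable.measurable (StronglyMeasurable.integral_prod_left'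
    (f := fun p : ℝ × T => V p.1 p.2 • H p.1) ?_)
  exact hV.stronglyMeasurable.smul (hH.comp_measurable measurable_fst)

variable [FiniteDimensional ℝ E]

omit hB in
theorem measurable_cellSum (hε : 0 < ε) : Measurable (cellSum V H ε) :=
  Finset.measurable_fun_sum _ fun j _ =>
    (measurable_cellIntegral hV hH hε j).comp (measurable_pi_apply j)

variable {π : Measure T} [IsProbabilityMeasure π] (hC : ∀ᵐ t ∂π, ∀ s, |V s t| ≤ C)

include hC

theorem abs_cgf_cellIntegral_le (hε : 0 < ε) (l : E) (j : ℕ) :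
    |cgf (fun t => inner ℝ l (cellIntegral V H ε j t)) π ε⁻¹| ≤ ‖l‖ * (C * B) := by
  have hm := measurable_cellIntegral hV hH hε j
  refine (abs_cgf_le (C := ‖l‖ * (C * B * ε)) (by fun_prop) ?_ _).trans ?_
  · filter_upwards [hC] with t ht
    exact (abs_real_inner_le_norm _ _).trans
      (by gcongr; exact norm_cellIntegral_le hB ht hε j)
  · rw [abs_of_pos (inv_pos.2 hε)]
    apply le_of_eq
    field_simp

theorem tendsto_cgf_cellIntegral (hVc : ∀ᵐ t ∂π, Continuous fun s => V s t) (l : E) {s : ℝ}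
    (hs : 0 ≤ s) (hHs : ContinuousAt H s) :
    Tendsto (fun ε : ℝ => cgf (fun t => inner ℝ l (cellIntegral V H ε ⌊s / ε⌋₊ t)) π ε⁻¹)
      (𝓝[>] 0) (𝓝 (cgf (V s) π (inner ℝ l (H s)))) := by
  have hVs : AEMeasurable (V s) π := (hV.comp measurable_prodMk_left).aemeasurable
  have hpos : 0 < mgf (V s) π (inner ℝ l (H s)) :=
    mgf_pos (integrable_exp_mul_of_ae_abs_le hVs (hC.mono fun t ht => ht s) _)
  refine Tendsto.log ?_ hpos.ne'
  refine tendsto_integral_filter_of_dominated_convergence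
    (fun _ => Real.exp (‖l‖ * (C * B))) ?_ ?_ (integrable_const _) ?_
  · filter_upwards [self_mem_nhdsWithin] with ε hε
    have hm := measurable_cellIntegral hV hH hε ⌊s / ε⌋₊
    exact (by fun_prop : Measurable _).aestronglyMeasurable
  · filter_upwards [self_mem_nhdsWithin] with ε hε
    have hε : (0 : ℝ) < ε := hε
    filter_upwards [hC] with t ht
    rw [Real.norm_eq_abs, abs_of_pos (Real.exp_pos _), Real.exp_le_exp, inv_mul_le_iff₀ hε]
    calc _ ≤ ‖l‖ * ‖cellIntegral V H ε ⌊s / ε⌋₊ t‖ := real_inner_le_norm _ _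
      _ ≤ ‖l‖ * (C * B * ε) := by gcongr; exact norm_cellIntegral_le hB ht hε _
      _ = _ := by ring
  · filter_upwards [hC, hVc] with t ht htc
    refine (Real.continuous_exp.tendsto _).comp ?_
    have havg := tendsto_cell_average (f := fun r => V r t • H r)
      (intervalIntegrable_smul_floor (ε := 1) (t := fun _ => t) hV hH hB fun _ => ht) hs
      (htc.continuousAt.smul hHs)
    have hl := ((innerSL ℝ l).continuous.tendsto _).comp havg
    simp only [Function.comp_def, innerSL_apply_apply, inner_smul_right] at hl
    rw [mul_comm]
    exact hl

/-- If the cells carry independent parameters with law `π`, the cell sums have a limiting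
logarithmic moment generating function. It is a sum of cell contributions by independence, that is,
the integral of a step function, which converges boundedly and almost everywhere. -/
theorem hasLimitLogMGF_cellSum {Ω : Type*} [MeasurableSpace Ω] {μ : Measure Ω}
    [IsProbabilityMeasure μ] {Θ : ℕ → Ω → T} (hΘ : ∀ j, Measurable (Θ j)) (hΘi : iIndepFun Θ μ)
    (hΘπ : ∀ j, μ.map (Θ j) = π) (hVc : ∀ᵐ t ∂π, Continuous fun s => V s t)
    (hHc : ∀ᵐ s : ℝ, ContinuousAt H s) (hH1 : ∀ s, 1 ≤ s → H s = 0) :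
    HasLimitLogMGF μ (fun ε ω => cellSum V H ε fun j => Θ j ω)
      (fun l => ∫ s in (0 : ℝ)..1, cgf (V s) π (inner ℝ l (H s))) (C * B) where
  measurable ε hε := (measurable_cellSum hV hH hε).comp (measurable_pi_lambda _ hΘ)
  norm_le ε hε := by
    have : ∀ᵐ ω ∂μ, ∀ j s, |V s (Θ j ω)| ≤ C := by
      rw [ae_all_iff]
      intro j
      exact ae_of_ae_map (hΘ j).aemeasurable (by rw [hΘπ j]; exact hC)
    filter_upwards [this] with ω hω using norm_cellSum_le hV hH hB hH1 hω hε
  tendsto l := by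
    set ψ : ℝ → ℕ → ℝ := fun ε j => cgf (fun t => inner ℝ l (cellIntegral V H ε j t)) π ε⁻¹ with hψ
    have hψb : ∀ ε, 0 < ε → ∀ j, |ψ ε j| ≤ ‖l‖ * (C * B) := fun ε hε j =>
      abs_cgf_cellIntegral_le hV hH hB hC hε l j
    have hψm : ∀ ε, Measurable fun s : ℝ => ψ ε ⌊s / ε⌋₊ := fun ε =>
      (measurable_from_nat (f := ψ ε)).comp (Nat.measurable_floor.comp (measurable_id.div_const ε))
    have hψi : ∀ ε, 0 < ε → ∀ a b, IntervalIntegrable (fun s => ψ ε ⌊s / ε⌋₊) volume a b :=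
      fun ε hε a b => (intervalIntegrable_const (c := ‖l‖ * (C * B))).mono_fun
        (hψm ε).aestronglyMeasurable (ae_of_all _ fun s => by
          rw [Real.norm_eq_abs]
          exact (hψb ε hε _).trans (le_abs_self _))
    -- the cells that meet `[0, 1)` are contained in `[0, 2]` if `ε ≤ 1`
    have hsum : ∀ᶠ ε : ℝ in 𝓝[>] 0, ε * Real.log
        (∫ ω, Real.exp (ε⁻¹ * inner ℝ l (cellSum V H ε fun j => Θ j ω)) ∂μ)
          = ∫ s in (0 : ℝ)..2, ψ ε ⌊s / ε⌋₊ := by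
      filter_upwards [self_mem_nhdsWithin, Ioc_mem_nhdsGT one_pos] with ε hε hε1
      have hε : (0 : ℝ) < ε := hε
      set X : ℕ → Ω → ℝ := fun j ω => inner ℝ l (cellIntegral V H ε j (Θ j ω)) with hX
      have hcm : ∀ j, Measurable fun t => inner ℝ l (cellIntegral V H ε j t) := fun j => by
        have hm := measurable_cellIntegral hV hH hε j
        fun_prop
      have hXm : ∀ j, Measurable (X j) := fun j => (hcm j).comp (hΘ j)
      have hXi : iIndepFun X μ := hΘi.comp _ hcm
      have hXcgf : ∀ j, cgf (X j) μ ε⁻¹ = ψ ε j := fun j => by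
        simp only [hψ, cgf]
        rw [← hΘπ j, mgf_map (hΘ j).aemeasurable]
        · rfl
        · exact ((hcm j).const_mul _).exp.aestronglyMeasurable
      have hXint : ∀ j, Integrable (fun ω => Real.exp (ε⁻¹ * X j ω)) μ := fun j => by
        refine integrable_exp_mul_of_ae_abs_le (C := ‖l‖ * (C * B * ε)) (hXm j).aemeasurable ?_ _
        refine ae_of_ae_map (p := fun t => |inner ℝ l (cellIntegral V H ε j t)| ≤ ‖l‖ * (C * B * ε))
          (hΘ j).aemeasurable ?_
        rw [hΘπ j]
        filter_upwards [hC] with t ht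
        exact (abs_real_inner_le_norm _ _).trans
          (by gcongr; exact norm_cellIntegral_le hB ht hε j)
      have hcgf := hXi.cgf_sum hXm (s := Finset.range ⌈ε⁻¹⌉₊) (t := ε⁻¹) fun j _ => hXint j
      have hint : ∫ ω, Real.exp (ε⁻¹ * inner ℝ l (cellSum V H ε fun j => Θ j ω)) ∂μ
          = mgf (∑ j ∈ Finset.range ⌈ε⁻¹⌉₊, X j) μ ε⁻¹ := by
        simp only [mgf, cellSum, inner_sum, Finset.sum_apply, hX]
      rw [hint, ← cgf, hcgf, Finset.mul_sum]
      have hcell : ∀ j : ℕ, ε * cgf (X j) μ ε⁻¹ = ∫ _ in (ε * j)..(ε * (j + 1)), ψ ε j := by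
        intro j
        rw [intervalIntegral.integral_const, hXcgf, smul_eq_mul]
        ring
      -- the sum over the cells is the integral of a step function, up to the cells beyond `1`
      simp only [hcell]
      rw [sum_integral_cells hε (fun j _ => ψ ε j) (hψi ε hε),
        ← intervalIntegral.integral_add_adjacent_intervals (hψi ε hε 0 (ε * ⌈ε⁻¹⌉₊))
          (hψi ε hε _ 2), eq_comm, add_eq_left]
      have h2 : ε * ⌈ε⁻¹⌉₊ ≤ 2 := by
        have := (Nat.ceil_lt_add_one (inv_pos.2 hε).le).le
        calc ε * ⌈ε⁻¹⌉₊ ≤ ε * (ε⁻¹ + 1) := by gcongr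
          _ = 1 + ε := by field_simp
          _ ≤ 2 := by linarith [hε1.2]
      rw [intervalIntegral.integral_congr (g := fun _ => (0 : ℝ)), intervalIntegral.integral_zero]
      intro s hs
      rw [uIcc_of_le h2] at hs
      have hfl : ⌈ε⁻¹⌉₊ ≤ ⌊s / ε⌋₊ := Nat.le_floor (by rw [le_div_iff₀' hε]; exact hs.1)
      have hcell0 : ∀ t, cellIntegral V H ε ⌊s / ε⌋₊ t = 0 := fun t => by
        have hle : ε * ⌊s / ε⌋₊ ≤ ε * (⌊s / ε⌋₊ + 1) := by gcongr; linarith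
        rw [cellIntegral, intervalIntegral.integral_congr (g := fun _ => (0 : E)),
          intervalIntegral.integral_zero]
        intro r hr
        rw [uIcc_of_le hle] at hr
        have h1 : 1 ≤ r := (one_le_mul_ceil_inv hε).trans (le_trans (by gcongr) hr.1)
        simp [hH1 r h1]
      simp [hψ, hcell0, cgf, mgf]
    have hlim : Tendsto (fun ε : ℝ => ∫ s in (0 : ℝ)..2, ψ ε ⌊s / ε⌋₊) (𝓝[>] 0)
        (𝓝 (∫ s in (0 : ℝ)..2, cgf (V s) π (inner ℝ l (H s)))) := by
      refine intervalIntegral.tendsto_integral_filter_of_dominated_convergence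
        (fun _ => ‖l‖ * (C * B)) ?_ ?_ intervalIntegrable_const ?_
      · exact Eventually.of_forall fun ε => (hψm ε).aestronglyMeasurable
      · filter_upwards [self_mem_nhdsWithin] with ε hε
        exact ae_of_all _ fun s _ => hψb ε hε _
      · filter_upwards [hHc] with s hs hs2
        rw [uIoc_of_le zero_le_two] at hs2
        exact tendsto_cgf_cellIntegral hV hH hB hC hVc l hs2.1.le hs
    have hcut : ∫ s in (0 : ℝ)..2, cgf (V s) π (inner ℝ l (H s))
        = ∫ s in (0 : ℝ)..1, cgf (V s) π (inner ℝ l (H s)) := by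
      have hi : ∀ a b, IntervalIntegrable (fun s => cgf (V s) π (inner ℝ l (H s))) volume a b :=
        fun a b => ⟨integrable_cgf_inner hV hC hB hH l, integrable_cgf_inner hV hC hB hH l⟩
      rw [← intervalIntegral.integral_add_adjacent_intervals (hi 0 1) (hi 1 2), add_eq_left,
        intervalIntegral.integral_congr (g := fun _ => (0 : ℝ)), intervalIntegral.integral_zero]
      intro s hs
      rw [uIcc_of_le one_le_two] at hs
      simp [hH1 s hs.1]
    rw [← hcut]
    exact hlim.congr' (hsum.mono fun ε h => h.symm)

end CellSum


/-! ### Regular conditional probabilities -/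

section Conditioning

variable {Ω X : Type*} [MeasurableSpace Ω] [MeasurableSpace X] {P : Measure Ω}
  {ξ : Ω → X} {κ : Kernel X Ω}

theorem map_compProd_eq_of_isCondKernel
    (hκ : (P.map fun ω => (ξ ω, ω)).IsCondKernel κ) :
    P.map ξ ⊗ₘ κ = P.map fun ω => (ξ ω, ω) := by
  have := hκ.disintegrate
  rwa [Measure.fst_map_prodMk measurable_id'] at this

variable [IsProbabilityMeasure P] [IsMarkovKernel κ]

theorem ae_ae_of_isCondKernel (hξ : Measurable ξ)
    (hκ : (P.map fun ω => (ξ ω, ω)).IsCondKernel κ) {p : Ω → Prop} (hp : ∀ᵐ ω ∂P, p ω) :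
    ∀ᵐ r ∂(P.map ξ), ∀ᵐ ω ∂(κ r), p ω := by
  have hsnd : (P.map fun ω => (ξ ω, ω)).map Prod.snd = P := by
    rw [Measure.map_map measurable_snd (hξ.prodMk measurable_id')]
    exact Measure.map_id
  refine Measure.ae_ae_of_ae_compProd (p := fun q => p q.2) ?_
  rw [map_compProd_eq_of_isCondKernel hκ]
  exact ae_of_ae_map measurable_snd.aemeasurable (by rwa [hsnd])

theorem ae_ae_eq_of_isCondKernel [MeasurableEq X] (hξ : Measurable ξ)
    (hκ : (P.map fun ω => (ξ ω, ω)).IsCondKernel κ) :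
    ∀ᵐ r ∂(P.map ξ), ∀ᵐ ω ∂(κ r), ξ ω = r := by
  refine Measure.ae_ae_of_ae_compProd (p := fun q => ξ q.2 = q.1) ?_
  have hset : MeasurableSet {q : X × Ω | ξ q.2 = q.1} :=
    measurableSet_eq_fun (hξ.comp measurable_snd) measurable_fst
  rw [map_compProd_eq_of_isCondKernel hκ,
    ae_map_iff (hξ.prodMk measurable_id').aemeasurable hset]
  exact ae_of_all _ fun ω => rfl

/-- The conditional law, given `ξ`, of a random variable independent of `ξ` is its law. -/
theorem ae_map_eq_of_indepFun {Y : Type*} [MeasurableSpace Y]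
    [MeasurableSpace.CountableOrCountablyGenerated X Y] (hξ : Measurable ξ)
    (hκ : (P.map fun ω => (ξ ω, ω)).IsCondKernel κ) {Θ : Ω → Y} (hΘ : Measurable Θ)
    (hi : IndepFun ξ Θ P) : ∀ᵐ r ∂(P.map ξ), (κ r).map Θ = P.map Θ := by
  have := Measure.isProbabilityMeasure_map (μ := P) hξ.aemeasurable
  have := Measure.isProbabilityMeasure_map (μ := P) hΘ.aemeasurable
  have hmarkov : IsMarkovKernel (κ.map Θ) := Kernel.IsMarkovKernel.map _ hΘ
  have h : P.map ξ ⊗ₘ κ.map Θ = P.map ξ ⊗ₘ Kernel.const X (P.map Θ) := by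
    rw [Measure.compProd_const, ← (indepFun_iff_map_prod_eq_prod_map_map hξ.aemeasurable
      hΘ.aemeasurable).1 hi, Measure.compProd_map hΘ, map_compProd_eq_of_isCondKernel hκ,
      Measure.map_map (by fun_prop) (by fun_prop)]
    rfl
  filter_upwards [Kernel.ae_eq_of_compProd_eq h] with r hr
  rwa [Kernel.map_apply _ hΘ, Kernel.const_apply] at hr

end Conditioning

/-! ### The medium and the oscillatory integrals -/

theorem highFreq_of_nonneg (νb : ℝ) (t : ℕ → ℝ) {y : ℝ} (hy : 0 ≤ y) :
    highFreq νb t y = νb * t ⌊y⌋₊ := by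
  rw [highFreq, tsum_eq_single ⌊y⌋₊]
  · rw [indicator_of_mem (show y ∈ Ico (⌊y⌋₊ : ℝ) (⌊y⌋₊ + 1) from
      ⟨Nat.floor_le hy, Nat.lt_floor_add_one y⟩)]
  · intro j hj
    refine indicator_of_notMem (fun h => hj ?_) _
    exact ((Nat.floor_eq_iff hy).2 h).symm

/-- `H` cut off outside `[0,1)`. With the cut-off the last cell, which may stick out of `[0,1]`, needs
no special treatment, and the values of `F` outside `[0,1]`, where `f` need not be integrable, play
no role. -/
def HvecCut (f : ℝ → ℝ) (x : ℝ) : ℝ → EuclideanSpace ℝ (Fin 4) :=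
  (Ico 0 1).indicator (Hvec f x)

theorem HvecCut_of_one_le (f : ℝ → ℝ) (x : ℝ) {s : ℝ} (hs : 1 ≤ s) : HvecCut f x s = 0 :=
  indicator_of_notMem (fun h => h.2.not_ge hs) _

theorem HvecCut_of_mem (f : ℝ → ℝ) (x : ℝ) {s : ℝ} (hs : s ∈ Ico (0 : ℝ) 1) :
    HvecCut f x s = Hvec f x s :=
  indicator_of_mem hs _

theorem exists_norm_HvecCut_le {f : ℝ → ℝ} (hf : IntervalIntegrable f volume 0 1) (x : ℝ) :
    ∃ B, 0 ≤ B ∧ ∀ s, ‖HvecCut f x s‖ ≤ B := by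
  obtain ⟨M, hM⟩ := isCompact_Icc.exists_bound_of_continuousOn (continuousOn_primitiveF hf)
  refine ⟨√(M ^ 2 + M ^ 2 + 1 + 1), Real.sqrt_nonneg _, fun s => ?_⟩
  by_cases hs : s ∈ Ico (0 : ℝ) 1
  · have hMs := hM s (Ico_subset_Icc_self hs)
    rw [HvecCut_of_mem f x hs, EuclideanSpace.norm_eq, Fin.sum_univ_four]
    refine Real.sqrt_le_sqrt ?_
    have h1 : ‖(Ioo 0 x).indicator (primitiveF f) s‖ ≤ M :=
      (norm_indicator_le_norm_self _ _).trans hMs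
    have h2 : ‖(Ioo 0 x).indicator (fun _ => (1 : ℝ)) s‖ ≤ 1 :=
      (norm_indicator_le_norm_self _ _).trans norm_one.le
    have h3 : ‖(1 : ℝ)‖ ^ 2 ≤ 1 := by simp
    have h4 : ‖(Ioo 0 x).indicator (fun _ => (1 : ℝ)) s‖ ^ 2 ≤ 1 :=
      pow_le_one₀ (norm_nonneg _) h2
    exact add_le_add (add_le_add (add_le_add (pow_le_pow_left₀ (norm_nonneg _) h1 2)
      (pow_le_pow_left₀ (norm_nonneg _) hMs 2)) h4) h3
  · rw [HvecCut, indicator_of_notMem hs, norm_zero]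
    exact Real.sqrt_nonneg _

theorem stronglyMeasurable_HvecCut {f : ℝ → ℝ} (hf : IntervalIntegrable f volume 0 1) (x : ℝ) :
    StronglyMeasurable (HvecCut f x) := by
  set F : ℝ → ℝ := IccExtend zero_le_one ((Icc 0 1).domRestrict (primitiveF f)) with hF
  have hFm : Measurable F :=
    (continuousOn_iff_continuous_domRestrict.1 (continuousOn_primitiveF hf)).Icc_extend'.measurable
  have heq : HvecCut f x = (Ico 0 1).indicator fun s => WithLp.toLp 2
      ![(Ioo 0 x).indicator F s, F s, (Ioo 0 x).indicator (fun _ => 1) s, 1] := by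
    refine indicator_congr fun s hs => ?_
    have hFs : F s = primitiveF f s := by
      rw [hF, IccExtend_of_mem _ _ (Ico_subset_Icc_self hs)]
      rfl
    have hFi : (Ioo 0 x).indicator F s = (Ioo 0 x).indicator (primitiveF f) s := by
      by_cases hm : s ∈ Ioo 0 x <;> simp [hm, hFs]
    rw [hFs, hFi]
    rfl
  rw [heq]
  refine (Measurable.indicator ?_ measurableSet_Ico).stronglyMeasurable
  refine (WithLp.measurable_toLp 2 _).comp (measurable_pi_iff.2 fun i => ?_)
  fin_cases i
  · exact hFm.indicator measurableSet_Ioo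
  · exact hFm
  · exact measurable_const.indicator measurableSet_Ioo
  · exact measurable_const

theorem ae_continuousAt_HvecCut {f : ℝ → ℝ} (hf : IntervalIntegrable f volume 0 1) {x : ℝ}
    (hx : x ∈ Ioo (0 : ℝ) 1) : ∀ᵐ s : ℝ, ContinuousAt (HvecCut f x) s := by
  have hfin : ∀ᵐ s : ℝ, s ∉ ({0, x, 1} : Set ℝ) :=
    measure_eq_zero_iff_ae_notMem.1 ((toFinite _).measure_zero volume)
  filter_upwards [hfin] with s hs
  simp only [mem_insert_iff, mem_singleton_iff, not_or] at hs
  have hF : s ∈ Ioo (0 : ℝ) 1 → ContinuousAt (primitiveF f) s := fun h =>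
    (continuousOn_primitiveF hf).continuousAt (Icc_mem_nhds h.1 h.2)
  have hcont : ∀ {g : ℝ → Fin 4 → ℝ}, (∀ i, ContinuousAt (fun s => g s i) s) →
      ContinuousAt (fun s => WithLp.toLp 2 (g s) : ℝ → EuclideanSpace ℝ (Fin 4)) s := fun hg =>
    (PiLp.continuous_toLp 2 _).continuousAt.comp (continuousAt_pi.2 hg)
  rcases lt_or_gt_of_ne hs.1 with h0 | h0
  · refine (continuousAt_const (y := (0 : EuclideanSpace ℝ (Fin 4)))).congr ?_
    filter_upwards [Iio_mem_nhds h0] with r hr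
    exact (indicator_of_notMem (fun h => hr.not_ge h.1) _).symm
  rcases lt_or_gt_of_ne hs.2.2 with h1 | h1
  · rcases lt_or_gt_of_ne hs.2.1 with h2 | h2
    · refine (hcont (g := fun r => ![primitiveF f r, primitiveF f r, 1, 1]) fun i => ?_).congr ?_
      · fin_cases i
        exacts [hF ⟨h0, h1⟩, hF ⟨h0, h1⟩, continuousAt_const, continuousAt_const]
      · filter_upwards [Ioo_mem_nhds h0 h2] with r hr
        rw [HvecCut_of_mem f x ⟨hr.1.le, hr.2.trans hx.2⟩, Hvec, indicator_of_mem hr,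
          indicator_of_mem hr]
    · refine (hcont (g := fun r => ![0, primitiveF f r, 0, 1]) fun i => ?_).congr ?_
      · fin_cases i
        exacts [continuousAt_const, hF ⟨h0, h1⟩, continuousAt_const, continuousAt_const]
      · filter_upwards [Ioo_mem_nhds h2 h1] with r hr
        have hr' : r ∉ Ioo 0 x := fun h => h.2.not_gt hr.1
        rw [HvecCut_of_mem f x ⟨(hx.1.trans hr.1).le, hr.2⟩, Hvec, indicator_of_notMem hr',
          indicator_of_notMem hr']
  · refine (continuousAt_const (y := (0 : EuclideanSpace ℝ (Fin 4)))).congr ?_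
    filter_upwards [Ioi_mem_nhds h1] with r hr
    exact (HvecCut_of_one_le f x (le_of_lt hr)).symm

theorem measurable_Valpha {b₀ : ℝ → ℝ} (hb : Continuous b₀) (νb : ℝ) :
    Measurable (Function.uncurry fun s t => Valpha νb (b₀ s) t) := by
  simp only [Function.uncurry_def, Valpha]
  have := hb.measurable
  fun_prop

theorem abs_Valpha_le {ν₁ νb α t : ℝ} (hν₁ : 0 < ν₁) (h : ν₁ ≤ α + νb * t) :
    |Valpha νb α t| ≤ 1 / ν₁ := by
  rw [Valpha, abs_of_pos (one_div_pos.2 (hν₁.trans_le h))]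
  exact one_div_le_one_div_of_le hν₁ h

theorem continuous_Valpha {b₀ : ℝ → ℝ} (hb : Continuous b₀) {ν₁ νb t : ℝ} (hν₁ : 0 < ν₁)
    (h : ∀ s, ν₁ ≤ b₀ s + νb * t) : Continuous fun s => Valpha νb (b₀ s) t :=
  continuous_const.div (hb.add continuous_const) fun s => (hν₁.trans_le (h s)).ne'

/-- The oscillatory integrals are sums of cell contributions. -/
theorem Zvec_eq_cellSum {f : ℝ → ℝ} (hf : IntervalIntegrable f volume 0 1) (x : ℝ)
    {b₀ : ℝ → ℝ} (hb : Continuous b₀) {ν₁ νb : ℝ} (hν₁ : 0 < ν₁) {t : ℕ → ℝ}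
    (ht : ∀ j s, ν₁ ≤ b₀ s + νb * t j) {ε : ℝ} (hε : 0 < ε) {A : ℝ → ℝ}
    (hA : ∀ s ∈ Ioo (0 : ℝ) 1, A s = b₀ s + νb * t ⌊s / ε⌋₊) :
    Zvec f x A = cellSum (fun s t => Valpha νb (b₀ s) t) (HvecCut f x) ε t := by
  obtain ⟨B, -, hB⟩ := exists_norm_HvecCut_le hf x
  have hV := measurable_Valpha hb νb
  have hH := stronglyMeasurable_HvecCut hf x
  have hC : ∀ j s, |Valpha νb (b₀ s) (t j)| ≤ 1 / ν₁ := fun j s => abs_Valpha_le hν₁ (ht j s)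
  rw [cellSum_eq_integral hV hH hB (fun s hs => HvecCut_of_one_le f x hs) hC hε]
  ext i
  have hproj := (EuclideanSpace.proj i : EuclideanSpace ℝ (Fin 4) →L[ℝ] ℝ).intervalIntegral_comp_comm
    (intervalIntegrable_smul_floor (ε := ε) hV hH hB hC 0 1)
  refine Eq.trans ?_ hproj
  simp only [Zvec, PiLp.proj_apply, PiLp.smul_apply, smul_eq_mul]
  rw [intervalIntegral.integral_of_le zero_le_one, intervalIntegral.integral_of_le zero_le_one,
    integral_Ioc_eq_integral_Ioo, integral_Ioc_eq_integral_Ioo]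
  refine setIntegral_congr_fun measurableSet_Ioo fun s hs => ?_
  simp only [hA s hs, HvecCut_of_mem f x (Ioo_subset_Ico_self hs), Valpha]
  rw [div_eq_mul_one_div, mul_comm]

/-! ### The contracted rate function -/

/-- A continuous extension to the whole space of the restriction of `g` to `{z | c ≤ z₄}`. -/
def gMapExt (c : ℝ) (z : EuclideanSpace ℝ (Fin 4)) : ℝ := -z 0 + z 1 * (z 2 / max (z 3) c)

theorem gMapExt_eq {c : ℝ} {z : EuclideanSpace ℝ (Fin 4)} (hz : c ≤ z 3) :
    gMapExt c z = gMap z := by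
  rw [gMapExt, gMap, max_eq_left hz]

theorem continuous_gMapExt {c : ℝ} (hc : 0 < c) : Continuous (gMapExt c) := by
  unfold gMapExt
  have h : ∀ z : EuclideanSpace ℝ (Fin 4), max (z 3) c ≠ 0 := fun z =>
    (hc.trans_le (le_max_right _ _)).ne'
  fun_prop (disch := exact h _)

theorem contractedRate_eq_imageRate {Λ : EuclideanSpace ℝ (Fin 4) → ℝ} {c : ℝ} (hc : 0 < c)
    (h : ∀ z, z ∈ {z : EuclideanSpace ℝ (Fin 4) | z 2 < c} ∪ {z | z 3 < c} →
      fenchelLegendre Λ z = ⊤) :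
    contractedRate Λ = imageRate (fenchelLegendre Λ) (gMapExt c) := by
  have hcases : ∀ z : EuclideanSpace ℝ (Fin 4),
      fenchelLegendre Λ z = ⊤ ∨ (c ≤ z 2 ∧ c ≤ z 3) := fun z => by
    by_cases hz : z ∈ {z : EuclideanSpace ℝ (Fin 4) | z 2 < c} ∪ {z | z 3 < c}
    · exact Or.inl (h z hz)
    · rw [mem_union, not_or] at hz
      exact Or.inr ⟨not_lt.1 hz.1, not_lt.1 hz.2⟩
  funext ℓ
  refine le_antisymm (le_iInf₂ fun z hz => ?_) (le_iInf₂ fun z hz => ?_) <;>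
    rcases hcases z with htop | hz'
  · simp [htop]
  · have hzg : gMapExt c z = ℓ := hz
    rw [gMapExt_eq hz'.2] at hzg
    exact iInf₂_le (f := fun w (_ : w ∈ {z | z ∈ gDomain ∧ gMap z = ℓ}) => fenchelLegendre Λ w) z
      ⟨⟨hc.trans_le hz'.1, hc.trans_le hz'.2⟩, hzg⟩
  · simp [htop]
  · obtain ⟨-, hzg⟩ := hz
    rw [← hzg, ← gMapExt_eq hz'.2]
    exact imageRate_le _ _ z


/-! ### Large deviations for a fixed low-frequency part -/

section FixedMedium

variable {π : Measure ℝ} {a₀ b₀ f : ℝ → ℝ} {νb ν₁ x : ℝ}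

theorem limitLogMGF_eq (hab : EqOn b₀ a₀ (Icc 0 1)) : limitLogMGF a₀ νb π f x =
    fun l => ∫ s in (0 : ℝ)..1, cgf (Valpha νb (b₀ s)) π (inner ℝ l (HvecCut f x s)) := by
  funext l
  rw [limitLogMGF, intervalIntegral.integral_of_le zero_le_one,
    intervalIntegral.integral_of_le zero_le_one, integral_Ioc_eq_integral_Ioo,
    integral_Ioc_eq_integral_Ioo]
  refine setIntegral_congr_fun measurableSet_Ioo fun s hs => ?_
  simp only [HvecCut_of_mem f x (Ioo_subset_Ico_self hs), hab (Ioo_subset_Icc_self hs)]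

/-- The assertions of the theorem for a medium `A ε` whose low-frequency part `a₀` is fixed. -/
theorem largeDeviations_of_fixed_medium {Ω : Type*} [MeasurableSpace Ω] {μ : Measure Ω}
    [IsProbabilityMeasure μ] {Θ : ℕ → Ω → ℝ} (hΘ : ∀ j, Measurable (Θ j)) (hΘi : iIndepFun Θ μ)
    (hΘπ : ∀ j, μ.map (Θ j) = π) (ha : ContinuousOn a₀ (Icc 0 1)) (hν₁ : 0 < ν₁) {ν₂ : ℝ}
    (hell : ∀ᵐ ω ∂μ, ∀ s ∈ Icc (0 : ℝ) 1, ∀ j, ν₁ ≤ a₀ s + νb * Θ j ω ∧ a₀ s + νb * Θ j ω ≤ ν₂)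
    {A : ℝ → Ω → ℝ → ℝ} (hA : ∀ ε : ℝ, 0 < ε → ∀ᵐ ω ∂μ, ∀ s ∈ Icc (0 : ℝ) 1,
      A ε ω s = a₀ s + νb * Θ ⌊s / ε⌋₊ ω)
    (hf : IntervalIntegrable f volume 0 1) (hx : x ∈ Ioo (0 : ℝ) 1) {u : ℝ → Ω → ℝ → ℝ}
    (hu : ∀ᵐ ω ∂μ, ∀ ε : ℝ, 0 < ε → IsWeakSolution (A ε ω) f (u ε ω)) :
    (∀ s ∈ Icc (0 : ℝ) 1, ∀ τ : ℝ,
      Integrable (fun t => Real.exp (τ * Valpha νb (a₀ s) t)) π) ∧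
    (∀ l : EuclideanSpace ℝ (Fin 4), IntervalIntegrable
      (fun s => cgf (Valpha νb (a₀ s)) π (inner ℝ l (Hvec f x s))) volume 0 1) ∧
    (∀ ε : ℝ, 0 < ε → ∀ l : EuclideanSpace ℝ (Fin 4), Integrable
      (fun ω => Real.exp (ε⁻¹ * inner ℝ l (Zvec f x (A ε ω)))) μ) ∧
    ContDiff ℝ (⊤ : ℕ∞) (limitLogMGF a₀ νb π f x) ∧
    ConvexOn ℝ univ (limitLogMGF a₀ νb π f x) ∧
    (∀ l : EuclideanSpace ℝ (Fin 4), Tendsto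
      (fun ε : ℝ => ε * Real.log
        (∫ ω, Real.exp (ε⁻¹ * inner ℝ l (Zvec f x (A ε ω))) ∂μ))
      (𝓝[>] 0) (𝓝 (limitLogMGF a₀ νb π f x l))) ∧
    IsGoodRateFunction (fenchelLegendre (limitLogMGF a₀ νb π f x)) ∧
    IsConvexEReal (fenchelLegendre (limitLogMGF a₀ νb π f x)) ∧
    SatisfiesLDP μ (fun ε ω => Zvec f x (A ε ω)) (fenchelLegendre (limitLogMGF a₀ νb π f x)) ∧
    IsGoodRateFunction (contractedRate (limitLogMGF a₀ νb π f x)) ∧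
    SatisfiesLDP μ (fun ε ω => u ε ω x) (contractedRate (limitLogMGF a₀ νb π f x)) := by
  -- extend `a₀` to a continuous function on the line with the same bounds
  set b₀ : ℝ → ℝ := IccExtend zero_le_one ((Icc 0 1).domRestrict a₀) with hb₀
  have hb : Continuous b₀ := (continuousOn_iff_continuous_domRestrict.1 ha).Icc_extend'
  have hab : EqOn b₀ a₀ (Icc 0 1) := fun s hs => by
    rw [hb₀, IccExtend_of_mem _ _ hs]
    rfl
  have hbval : ∀ s, ∃ r ∈ Icc (0 : ℝ) 1, b₀ s = a₀ r := fun s =>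
    ⟨projIcc 0 1 zero_le_one s, (projIcc 0 1 zero_le_one s).2, rfl⟩
  have hellb : ∀ᵐ ω ∂μ, ∀ j s, ν₁ ≤ b₀ s + νb * Θ j ω := by
    filter_upwards [hell] with ω hω j s
    obtain ⟨r, hr, hs⟩ := hbval s
    rw [hs]
    exact (hω r hr j).1
  have hellπ : ∀ᵐ t ∂π, ∀ s, ν₁ ≤ b₀ s + νb * t := by
    have hset : MeasurableSet {t : ℝ | ∀ s, ν₁ ≤ b₀ s + νb * t} := by
      refine IsClosed.measurableSet ?_
      rw [ofPred_forall]
      exact isClosed_iInter fun s => isClosed_le continuous_const (by fun_prop)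
    rw [← hΘπ 0, ae_map_iff (hΘ 0).aemeasurable hset]
    exact hellb.mono fun ω hω => hω 0
  have hπ : IsProbabilityMeasure π :=
    hΘπ 0 ▸ Measure.isProbabilityMeasure_map (hΘ 0).aemeasurable
  set V : ℝ → ℝ → ℝ := fun s t => Valpha νb (b₀ s) t with hVdef
  have hV : Measurable (Function.uncurry V) := measurable_Valpha hb νb
  have hC : ∀ᵐ t ∂π, ∀ s, |V s t| ≤ 1 / ν₁ :=
    hellπ.mono fun t ht s => abs_Valpha_le hν₁ (ht s)
  have hVc : ∀ᵐ t ∂π, Continuous fun s => V s t :=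
    hellπ.mono fun t ht => continuous_Valpha hb hν₁ ht
  obtain ⟨B, hB0, hB⟩ := exists_norm_HvecCut_le hf x
  have hH := stronglyMeasurable_HvecCut hf x
  have hZ : ∀ ε : ℝ, 0 < ε →
      (fun ω => cellSum V (HvecCut f x) ε fun j => Θ j ω) =ᵐ[μ] fun ω => Zvec f x (A ε ω) := by
    intro ε hε
    filter_upwards [hellb, hA ε hε] with ω hω hAω
    refine (Zvec_eq_cellSum hf x hb hν₁ hω hε fun s hs => ?_).symm
    rw [hAω s (Ioo_subset_Icc_self hs), hab (Ioo_subset_Icc_self hs)]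
  set Λ := limitLogMGF a₀ νb π f x with hΛ
  have hΛeq : Λ = fun l => ∫ s in (0 : ℝ)..1, cgf (V s) π (inner ℝ l (HvecCut f x s)) :=
    limitLogMGF_eq hab
  have hΛeq' : Λ = fun l => ∫ s in Ioc (0 : ℝ) 1, cgf (V s) π (inner ℝ l (HvecCut f x s)) := by
    simpa only [intervalIntegral.integral_of_le zero_le_one] using hΛeq
  have hlim : HasLimitLogMGF μ (fun ε ω => cellSum V (HvecCut f x) ε fun j => Θ j ω) Λ
      (1 / ν₁ * B) := by
    rw [hΛeq]
    exact hasLimitLogMGF_cellSum hV hH hB hC hΘ hΘi hΘπ hVc (ae_continuousAt_HvecCut hf hx)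
      fun s hs => HvecCut_of_one_le f x hs
  have hexp : ∀ ε : ℝ, 0 < ε → ∀ l : EuclideanSpace ℝ (Fin 4),
      (fun ω => Real.exp (ε⁻¹ * inner ℝ l (cellSum V (HvecCut f x) ε fun j => Θ j ω))) =ᵐ[μ]
        fun ω => Real.exp (ε⁻¹ * inner ℝ l (Zvec f x (A ε ω))) := fun ε hε l =>
    (hZ ε hε).mono fun ω hω => by simp only [hω]
  have hsmooth : ContDiff ℝ (⊤ : ℕ∞) Λ := by
    rw [hΛeq']
    exact contDiff_integral_cgf_inner hV hC hH hB
  have hgood : IsGoodRateFunction (fenchelLegendre Λ) := by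
    refine isGoodRateFunction_fenchelLegendre (C := 1 / ν₁ * B) hlim.map_zero (by positivity)
      fun l => (le_abs_self _).trans ?_
    rw [hΛeq']
    simpa using abs_integral_cgf_inner_le (μ := volume.restrict (Ioc (0 : ℝ) 1)) hV hC hB
      (by positivity) l
  have hldp : SatisfiesLDP μ (fun ε ω => Zvec f x (A ε ω)) (fenchelLegendre Λ) :=
    (hlim.satisfiesLDP (hsmooth.differentiable (by simp))).congr_ae hZ
  -- the coefficient is measurable in space and satisfies the bounds
  have hAmeas : ∀ ε : ℝ, 0 < ε → ∀ᵐ ω ∂μ,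
      AEStronglyMeasurable (A ε ω) (volume.restrict (Ioo (0 : ℝ) 1)) ∧
        ∀ s ∈ Icc (0 : ℝ) 1, ν₁ ≤ A ε ω s ∧ A ε ω s ≤ ν₂ := by
    intro ε hε
    filter_upwards [hell, hA ε hε] with ω hω hAω
    refine ⟨?_, fun s hs => hAω s hs ▸ hω s hs _⟩
    have hm : Measurable fun s : ℝ => b₀ s + νb * Θ ⌊s / ε⌋₊ ω :=
      hb.measurable.add (((measurable_from_nat (f := fun j => Θ j ω)).comp
        (Nat.measurable_floor.comp (measurable_id.div_const ε))).const_mul νb)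
    refine hm.aestronglyMeasurable.congr ?_
    filter_upwards [ae_restrict_mem measurableSet_Ioo] with s hs
    rw [hAω s (Ioo_subset_Icc_self hs), hab (Ioo_subset_Icc_self hs)]
  have hν₂ : 0 < ν₂ := by
    obtain ⟨ω, hω⟩ := hell.exists
    have := hω 0 (by simp) 0
    exact hν₁.trans_le (this.1.trans this.2)
  have hc : 0 < x / ν₂ := div_pos hx.1 hν₂
  have hge : ∀ ε : ℝ, 0 < ε → ∀ᵐ ω ∂μ,
      x / ν₂ ≤ Zvec f x (A ε ω) 2 ∧ x / ν₂ ≤ Zvec f x (A ε ω) 3 := by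
    intro ε hε
    filter_upwards [hAmeas ε hε] with ω hω
    rw [Zvec_two hx, Zvec_three]
    refine ⟨le_intervalIntegral_one_div hν₁ hω.1 hω.2 (Ioo_subset_Icc_self hx), le_trans ?_
      (le_intervalIntegral_one_div hν₁ hω.1 hω.2 (right_mem_Icc.2 zero_le_one))⟩
    gcongr
    exact hx.2.le
  have hrate : contractedRate Λ = imageRate (fenchelLegendre Λ) (gMapExt (x / ν₂)) := by
    refine contractedRate_eq_imageRate hc fun z hz => hldp.eq_top_of_ae_notMem ?_ ?_ hz
    · exact (isOpen_lt (by fun_prop) continuous_const).union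
        (isOpen_lt (by fun_prop) continuous_const)
    · intro ε hε
      filter_upwards [hge ε hε] with ω hω hmem
      exact hmem.elim (fun h => hω.1.not_gt h) fun h => hω.2.not_gt h
  refine ⟨fun s hs τ => ?_, fun l => ?_, fun ε hε l => (hlim.integrable_exp hε l).congr (hexp ε hε l),
    hsmooth, ?_, fun l => ?_, hgood, isConvexEReal_fenchelLegendre Λ, hldp, ?_, ?_⟩
  · have := integrable_exp_mul_of_ae_abs_le (hV.comp (measurable_prodMk_left (x := s))).aemeasurable
      (hC.mono fun t ht => ht s) τ
    simpa only [V, Function.comp_def, Function.uncurry_apply_pair, hab hs] using this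
  · rw [intervalIntegrable_iff_integrableOn_Ioo_of_le zero_le_one]
    refine (integrable_cgf_inner (μ := volume.restrict (Ioo (0 : ℝ) 1)) hV hC hB hH l).congr ?_
    filter_upwards [ae_restrict_mem measurableSet_Ioo] with s hs
    simp only [V, HvecCut_of_mem f x (Ioo_subset_Ico_self hs), hab (Ioo_subset_Icc_self hs)]
  · rw [hΛeq']
    exact convexOn_integral_cgf_inner hV hC hB hH
  · refine (hlim.tendsto l).congr' ?_
    filter_upwards [self_mem_nhdsWithin] with ε hε
    rw [integral_congr_ae (hexp ε hε l)]
  · rw [hrate]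
    exact hgood.imageRate (continuous_gMapExt hc)
  · rw [hrate]
    refine (hldp.comp (continuous_gMapExt hc)).congr_ae fun ε hε => ?_
    filter_upwards [hAmeas ε hε, hge ε hε, hu] with ω hω hωge hω_u
    rw [(hω_u ε hε).apply_eq_gMap hν₁ hω.1 hω.2 hf hx, gMapExt_eq hωge.2]

end FixedMedium

end

theorem theorem3
    {Ω : Type*} [MeasurableSpace Ω] (P : Measure Ω) [IsProbabilityMeasure P]
    -- the low-frequency parameter `ξ` and the high-frequency parameters `θ`
    {m : ℕ} (ξ : Ω → Fin m → ℝ) (hξ : Measurable ξ)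
    (θ : ℕ → Ω → ℝ) (hθ : ∀ j, Measurable (θ j))
    (πθ : Measure ℝ) (hlaw : ∀ j, P.map (θ j) = πθ)
    (hiid : iIndepFun θ P) (hindep : IndepFun ξ (fun ω j => θ j ω) P)
    (hbound : ∀ j, ∀ᵐ ω ∂P, |θ j ω| ≤ 1)
    -- the medium
    (a : ℝ → (Fin m → ℝ) → ℝ) (ha : ∀ ω, ContinuousOn (fun s => a s (ξ ω)) (Icc 0 1))
    (νb ν₁ ν₂ : ℝ) (hν₁ : 0 < ν₁)
    (hell : ∀ᵐ ω ∂P, ∀ s ∈ Icc (0 : ℝ) 1, ∀ y : ℝ, 0 ≤ y →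
      ν₁ ≤ medium a νb ξ θ ω s y ∧ medium a νb ξ θ ω s y ≤ ν₂)
    -- the conditional probability `P_ξ = P[· | ξ]`
    (Pξ : Kernel (Fin m → ℝ) Ω) [IsMarkovKernel Pξ]
    (hPξ : (P.map (fun ω => (ξ ω, ω))).IsCondKernel Pξ)
    -- the right-hand side, the point `x` and the solutions `u_ε`
    (f : ℝ → ℝ) (hf : MemLp f 2 (volume.restrict (Ioo (0 : ℝ) 1)))
    (x : ℝ) (hx : x ∈ Ioo (0 : ℝ) 1)
    (u : ℝ → Ω → ℝ → ℝ)
    (hu : ∀ᵐ ω ∂P, ∀ ε : ℝ, 0 < ε → IsWeakSolution (mediumEps a νb ξ θ ε ω) f (u ε ω)) :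
    ∀ᵐ r ∂(P.map ξ),
      -- the expectations and the integral below are those of integrable functions
      (∀ s ∈ Icc (0 : ℝ) 1, ∀ τ : ℝ,
        Integrable (fun t => Real.exp (τ * Valpha νb (a s r) t)) πθ) ∧
      (∀ l : EuclideanSpace ℝ (Fin 4), IntervalIntegrable
        (fun s => cgf (Valpha νb (a s r)) πθ (inner ℝ l (Hvec f x s))) volume 0 1) ∧
      (∀ ε : ℝ, 0 < ε → ∀ l : EuclideanSpace ℝ (Fin 4), Integrable
        (fun ω => Real.exp (ε⁻¹ * inner ℝ l (Zvec f x (mediumEps a νb ξ θ ε ω)))) (Pξ r)) ∧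
      -- `Λ` is smooth and convex, and it is the limiting logarithmic moment generating function
      ContDiff ℝ (⊤ : ℕ∞) (limitLogMGF (fun s => a s r) νb πθ f x) ∧
      ConvexOn ℝ univ (limitLogMGF (fun s => a s r) νb πθ f x) ∧
      (∀ l : EuclideanSpace ℝ (Fin 4), Tendsto
        (fun ε : ℝ => ε * Real.log
          (∫ ω, Real.exp (ε⁻¹ * inner ℝ l (Zvec f x (mediumEps a νb ξ θ ε ω))) ∂(Pξ r)))
        (𝓝[>] 0) (𝓝 (limitLogMGF (fun s => a s r) νb πθ f x l))) ∧
      -- the large deviation principle for `Z_ε`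
      IsGoodRateFunction (fenchelLegendre (limitLogMGF (fun s => a s r) νb πθ f x)) ∧
      IsConvexEReal (fenchelLegendre (limitLogMGF (fun s => a s r) νb πθ f x)) ∧
      SatisfiesLDP (Pξ r) (fun ε ω => Zvec f x (mediumEps a νb ξ θ ε ω))
        (fenchelLegendre (limitLogMGF (fun s => a s r) νb πθ f x)) ∧
      -- the large deviation principle for `u_ε(x)`
      IsGoodRateFunction (contractedRate (limitLogMGF (fun s => a s r) νb πθ f x)) ∧
      SatisfiesLDP (Pξ r) (fun ε ω => u ε ω x)
        (contractedRate (limitLogMGF (fun s => a s r) νb πθ f x)) := by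
  have hΘ : Measurable fun ω j => θ j ω := measurable_pi_lambda _ hθ
  have hmap : ∀ μ : Measure Ω, ∀ j, μ.map (θ j) = (μ.map fun ω j => θ j ω).map fun t => t j :=
    fun μ j => by rw [Measure.map_map (measurable_pi_apply j) hΘ]; rfl
  filter_upwards [ae_ae_eq_of_isCondKernel hξ hPξ, ae_ae_of_isCondKernel hξ hPξ hell,
    ae_ae_of_isCondKernel hξ hPξ hu, ae_map_eq_of_indepFun hξ hPξ hΘ hindep] with r hr hell hu hlawr
  have hθr : ∀ j, (Pξ r).map (θ j) = P.map (θ j) := fun j => by rw [hmap, hlawr, ← hmap]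
  have hiid' : iIndepFun θ (Pξ r) := by
    rw [iIndepFun_iff_map_fun_eq_infinitePi_map hθ] at hiid ⊢
    simp only [hθr]
    rw [hlawr, hiid]
  have har : ContinuousOn (fun s => a s r) (Icc 0 1) := by
    obtain ⟨ω, hω⟩ := hr.exists
    simpa only [hω] using ha ω
  refine largeDeviations_of_fixed_medium (ν₂ := ν₂) hθ hiid' (fun j => (hθr j).trans (hlaw j)) har
    hν₁ ?_ (fun ε hε => ?_) (memLp_two_intervalIntegrable hf) hx hu
  · filter_upwards [hr, hell] with ω hω hω' s hs j
    have := hω' s hs j (Nat.cast_nonneg j)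
    rwa [medium, hω, highFreq_of_nonneg _ _ (Nat.cast_nonneg j), Nat.floor_natCast] at this
  · filter_upwards [hr] with ω hω s hs
    rw [mediumEps, medium, hω, highFreq_of_nonneg _ _ (div_nonneg hs.1 hε.le)]
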